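/- Let $G$ be a (real, finite-dimensional) semisimple Lie group contained in its universal complexification $G_{\mathbb C}$ (i.e. the canonical homomorphism $G\to G_{\mathbb C}$ is injective), and let $\mathfrak g$ be the Lie algebra of $G$. Let $K<G$ be a maximal compact subgroup with Lie algebra $\mathfrak k$, let $\theta$ be a Cartan involution of $\mathfrak g$ with fixed algebra $\mathfrak k$, let $\mathfrak g=\mathfrak k\oplus\mathfrak p$ be the corresponding Cartan decomposition, and let $\mathfrak a\subseteq\mathfrak p$ be a maximal abelian subspace, with restricted root system $\Sigma=\Sigma(\mathfrak g,\mathfrak a)\subseteq\mathfrak a^*$. Let $K_{\mathbb C}$ be the complexification of $K$ in $G_{\mathbb C}$, i.e. the subgroup of $G_{\mathbb C}$ generated by $K$ and $\exp(i\mathfrak k)$. Put $$\Omega=\{X\in\mathfrak a : |\alpha(X)|<\tfrac{\pi}{2}\ \text{ for all }\alpha\in\Sigma\},$$ and let $\partial_e\Omega$ be the set of extreme points of the closure $\overline\Omega$ of $\Omega$ in $\mathfrak a$. Define the complex crown $\Xi$ and its distinguished boundary $\partial_d\Xi$ as the subsets $$\Xi=G\exp(i\Omega)K_{\mathbb C}/K_{\mathbb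 C},\qquad \partial_d\Xi=G\exp(i\,\partial_e\Omega)K_{\mathbb C}/K_{\mathbb C}$$ of $G_{\mathbb C}/K_{\mathbb C}$, and let $\overline\Xi$ be the closure of $\Xi$ in $G_{\mathbb C}/K_{\mathbb C}$. Let $\mathcal A(\Xi)$ be the set of continuous functions $f:\overline\Xi\to\mathbb C$ which are holomorphic on $\Xi$ and satisfy $\sup_{z\in\Xi}|f(z)|<\infty$. Then $\emptyset\neq\partial_d\Xi\subseteq\overline\Xi$, and every $f\in\mathcal A(\Xi)$ is bounded on $\partial_d\Xi$ and satisfies $$\sup_{z\in\Xi}|f(z)|=\sup_{z\in\partial_d\Xi}|f(z)| .$$ -/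

import Mathlib

open scoped Manifold ContDiff

universe u

noncomputable section

namespace Crown

/-- A smooth real Lie group has the regularity under which its Lie bracket is defined. -/
instance : ENat.LEInfty (minSmoothness ℝ 3) :=
  ⟨by simp only [minSmoothness_of_isRCLikeNormedField]; exact ENat.LEInfty.out⟩

/-! ### Lie groups, exponential map, universal complexification -/

section LieGroupBasics

variable {𝕜 : Type*} [NontriviallyNormedField 𝕜]
  {E : Type*} [NormedAddCommGroup E] [NormedSpace 𝕜 E]
  {G : Type*} [TopologicalSpace G] [ChartedSpace E G] [Group G]

/-- `γ : 𝕜 → G` is the integral curve through the identity of the left-invariant vector field on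
the Lie group `G` (over `𝕜 = ℝ` or `ℂ`) with value `v` at the identity; equivalently, the
one-parameter subgroup of `G` with initial velocity `v`. -/
def IsOneParameterCurve (v : GroupLieAlgebra 𝓘(𝕜, E) G) (γ : 𝕜 → G) : Prop :=
  γ 0 = 1 ∧
    ∀ t : 𝕜, HasMFDerivAt 𝓘(𝕜, 𝕜) 𝓘(𝕜, E) γ t
      ((1 : 𝕜 →L[𝕜] 𝕜).smulRight (mulInvariantVectorField v (γ t)))

open Classical in
/-- The exponential map `exp : Lie(G) → G` of a real or complex Lie group: `exp v = γ 1`, with `γ`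
the integral curve through `1` of the left-invariant vector field defined by `v`.
(In a Lie group such a curve always exists and is unique.) -/
def lieExp (v : GroupLieAlgebra 𝓘(𝕜, E) G) : G :=
  if h : ∃ γ : 𝕜 → G, IsOneParameterCurve v γ then h.choose 1 else 1

end LieGroupBasics

section RealLie

variable (E : Type*) [NormedAddCommGroup E] [NormedSpace ℝ E]
  {G : Type u} [TopologicalSpace G] [ChartedSpace E G] [Group G]

/-- The Lie algebra `{X | exp(tX) ∈ K for all t ∈ ℝ}` of a (closed) subgroup `K` of a real Lie
group `G`, as a subset of the Lie algebra of `G`. -/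
def lieAlgebraOf (K : Subgroup G) : Set (GroupLieAlgebra 𝓘(ℝ, E) G) :=
  {X | ∀ t : ℝ, lieExp (t • X) ∈ K}

variable (E' : Type*) [NormedAddCommGroup E'] [NormedSpace ℂ E']
  {GC : Type u} [TopologicalSpace GC] [ChartedSpace E' GC] [Group GC]

/-- `ι : G → GC` is the universal complexification of the real Lie group `G`: a smooth homomorphism
to the complex Lie group `GC` such that every smooth homomorphism from `G` to a complex Lie group
`H` factors uniquely as a holomorphic homomorphism `GC → H` after `ι`. -/
structure IsUniversalComplexification (ι : G →* GC) : Prop where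
  smooth : ContMDiff 𝓘(ℝ, E) 𝓘(ℝ, E') ∞ ι
  existsUnique_lift : ∀ (n : ℕ) (H : Type u) [TopologicalSpace H] [T2Space H]
    [ChartedSpace (EuclideanSpace ℂ (Fin n)) H] [Group H]
    [LieGroup 𝓘(ℂ, EuclideanSpace ℂ (Fin n)) ω H] (φ : G →* H),
    ContMDiff 𝓘(ℝ, E) 𝓘(ℝ, EuclideanSpace ℂ (Fin n)) ∞ φ →
      ∃! ψ : GC →* H,
        ContMDiff 𝓘(ℂ, E') 𝓘(ℂ, EuclideanSpace ℂ (Fin n)) ω ψ ∧ ψ.comp ι = φ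

variable {E} in
/-- The differential at the identity `dι : Lie(G) → Lie(GC)` of a homomorphism `ι : G → GC`. The
target, the tangent space of `GC` at `ι 1 = 1`, is regarded as the complex Lie algebra of `GC`. -/
def lieDifferential (ι : G →* GC) (X : GroupLieAlgebra 𝓘(ℝ, E) G) :
    GroupLieAlgebra 𝓘(ℂ, E') GC :=
  (mfderiv 𝓘(ℝ, E) 𝓘(ℝ, E') ι 1 X : E')

variable {E} in
/-- The element `exp(iX)` of `GC`, for `X` in the Lie algebra of `G`. -/
def expI (ι : G →* GC) (X : GroupLieAlgebra 𝓘(ℝ, E) G) : GC :=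
  lieExp (Complex.I • lieDifferential E' ι X)

/-- The complexification `K_ℂ` of a compact subgroup `K` of `G`, realized in `GC`: the subgroup
generated by (the image of) `K` and the elements `exp(iX)`, `X ∈ Lie(K)`. -/
def complexifiedSubgroup (ι : G →* GC) (K : Subgroup G) : Subgroup GC :=
  Subgroup.closure ((ι '' (K : Set G)) ∪ (expI E' ι '' (lieAlgebraOf E K)))

/-- The homogeneous space `G_ℂ / K_ℂ`, with its quotient topology. -/
abbrev ComplexQuotient (ι : G →* GC) (K : Subgroup G) : Type u :=
  GC ⧸ complexifiedSubgroup E E' ι K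

variable {E} in
/-- For a subspace `𝔞` of the Lie algebra of `G` and `S ⊆ 𝔞`, the subset `G exp(iS) K_ℂ / K_ℂ` of
`G_ℂ / K_ℂ`. -/
def orbitSet (ι : G →* GC) (K : Subgroup G) {𝔞 : Submodule ℝ (GroupLieAlgebra 𝓘(ℝ, E) G)}
    (S : Set 𝔞) : Set (ComplexQuotient E E' ι K) :=
  {z | ∃ g : G, ∃ X ∈ S, z = ((ι g * expI E' ι (X : GroupLieAlgebra 𝓘(ℝ, E) G) : GC) :
    GC ⧸ complexifiedSubgroup E E' ι K)}

end RealLie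

/-! ### Cartan decomposition and restricted roots -/

section CartanDecomposition

variable {𝔤 : Type*} [LieRing 𝔤] [LieAlgebra ℝ 𝔤]

/-- `θ` is a Cartan involution of the real Lie algebra `𝔤`: an involutive automorphism such that
the form `(X, Y) ↦ -κ(X, θ Y)` is positive definite, where `κ` is the Killing form. -/
structure IsCartanInvolution (θ : 𝔤 →ₗ⁅ℝ⁆ 𝔤) : Prop where
  involutive : ∀ X, θ (θ X) = X
  posDef : ∀ X, X ≠ 0 → 0 < -(killingForm ℝ 𝔤 X (θ X))

/-- `𝔞` is an abelian subspace of `𝔭 = {X | θ X = -X}`. -/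
def IsAbelianSubspaceOfP (θ : 𝔤 →ₗ⁅ℝ⁆ 𝔤) (𝔞 : Submodule ℝ 𝔤) : Prop :=
  (∀ X ∈ 𝔞, θ X = -X) ∧ ∀ X ∈ 𝔞, ∀ Y ∈ 𝔞, ⁅X, Y⁆ = 0

/-- The restricted root system `Σ(𝔤, 𝔞)`: the nonzero linear forms `α` on `𝔞` whose root space
`{X | ∀ H ∈ 𝔞, [H, X] = α(H) X}` is nonzero. -/
def restrictedRoots (𝔞 : Submodule ℝ 𝔤) : Set (Module.Dual ℝ 𝔞) :=
  {α | α ≠ 0 ∧ ∃ X : 𝔤, X ≠ 0 ∧ ∀ H : 𝔞, ⁅(H : 𝔤), X⁆ = α H • X}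

/-- The polyhedral domain `Ω = {X ∈ 𝔞 | |α(X)| < π/2 for all restricted roots α}`. -/
def omega (𝔞 : Submodule ℝ 𝔤) : Set 𝔞 :=
  {X | ∀ α ∈ restrictedRoots 𝔞, |α X| < Real.pi / 2}

/-- The set `∂ₑΩ` of extreme points of the closure of `Ω`. -/
def extremeOmega [TopologicalSpace 𝔤] (𝔞 : Submodule ℝ 𝔤) : Set 𝔞 :=
  Set.extremePoints ℝ (closure (omega 𝔞))

end CartanDecomposition

/-! ### The complex crown -/

section CrownDomain

variable {E : Type*} [NormedAddCommGroup E] [NormedSpace ℝ E] [CompleteSpace E]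
  {G : Type u} [TopologicalSpace G] [ChartedSpace E G] [Group G] [LieGroup 𝓘(ℝ, E) ∞ G]
  (E' : Type*) [NormedAddCommGroup E'] [NormedSpace ℂ E']
  {GC : Type u} [TopologicalSpace GC] [ChartedSpace E' GC] [Group GC]

/-- The complex crown `Ξ = G exp(iΩ) K_ℂ / K_ℂ`. -/
def crown (ι : G →* GC) (K : Subgroup G) (𝔞 : Submodule ℝ (GroupLieAlgebra 𝓘(ℝ, E) G)) :
    Set (ComplexQuotient E E' ι K) :=
  orbitSet E' ι K (omega 𝔞)

/-- The distinguished boundary `∂_d Ξ = G exp(i ∂ₑΩ) K_ℂ / K_ℂ`. -/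
def distinguishedBoundary (ι : G →* GC) (K : Subgroup G)
    (𝔞 : Submodule ℝ (GroupLieAlgebra 𝓘(ℝ, E) G)) : Set (ComplexQuotient E E' ι K) :=
  orbitSet E' ι K (extremeOmega 𝔞)

/-- The algebra `𝒜(Ξ)` of the functions which are continuous on the closure of `Ξ` in
`G_ℂ / K_ℂ`, holomorphic on `Ξ` and bounded on `Ξ`. The complex structure of `G_ℂ / K_ℂ` is the
quotient structure: a function on an open subset `U` of `G_ℂ / K_ℂ` is holomorphic if its pullback
to the preimage of `U` in the complex Lie group `G_ℂ` is holomorphic. Elements are represented by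
functions on all of `G_ℂ / K_ℂ`; their values outside the closure of `Ξ` are irrelevant. -/
def crownAlgebra (ι : G →* GC) (K : Subgroup G)
    (𝔞 : Submodule ℝ (GroupLieAlgebra 𝓘(ℝ, E) G)) : Set (ComplexQuotient E E' ι K → ℂ) :=
  {f | ContinuousOn f (closure (crown E' ι K 𝔞)) ∧
    MDifferentiableOn 𝓘(ℂ, E') 𝓘(ℂ, ℂ)
      (fun x : GC => f (x : GC ⧸ complexifiedSubgroup E E' ι K))
      {x : GC | (x : GC ⧸ complexifiedSubgroup E E' ι K) ∈ crown E' ι K 𝔞} ∧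
    BddAbove ((fun z => ‖f z‖) '' crown E' ι K 𝔞)}

end CrownDomain

end Crown

end

/-! Fix a bound `C` for `‖f‖` on the distinguished boundary, and let `D` be the set of `X` in the
closure of `Ω` such that `‖f‖ ≤ C` on the whole orbit `G exp(iX) K_ℂ / K_ℂ`. This set contains the
extreme points, and it is closed because `f` is continuous on the closure of `Ξ`. If it is also
convex, Krein–Milman puts the closure of `Ω` inside `D`, which is the theorem
(`norm_le_of_norm_le_on_distinguishedBoundary`).

Convexity is a three lines argument (`norm_le_on_segment`). For `X, Y ∈ D` and `W = Y - X`, the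
holomorphic map `z ↦ g exp(izW) exp(iX)` takes the value `g exp(-Im z W) exp(i(X + Re z W))`, since
`𝔞` is abelian (`map_mul_complexExp_mul_expI`). The strip `0 ≤ Re z ≤ 1` therefore maps to the
closure of `Ξ`, and its two edges map to the orbits of `exp(iX)` and `exp(iY)`, where `C` is a
bound. The strip may land in the boundary of `Ξ`, where `f` is only continuous; replacing `X, W` by
`rX, rW` with `r < 1` moves it into `Ξ`, and holomorphy survives the limit `r → 1`
(`norm_le_on_strip_of_limit`).

Krein–Milman needs the closure of `Ω` to be compact (`isCompact_closure_omega`), that is, the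
restricted roots must separate the points of `𝔞`; this follows from simultaneous diagonalization of
`ad 𝔞`.

The rest is the theory of `lieExp`: real one-parameter subgroups exist and are unique, a vanishing
bracket makes them commute, and a complex one is assembled from the commuting real ones with
velocities `v` and `iv`. -/

noncomputable section

namespace Crown

/-! ### Complex manifolds and Lie groups regarded as real ones. -/

section RestrictScalars

variable {E : Type*} [NormedAddCommGroup E] [NormedSpace ℂ E]
  {M : Type*} [TopologicalSpace M] [ChartedSpace E M]
  {F : Type*} [NormedAddCommGroup F] [NormedSpace ℂ F]
  {N : Type*} [TopologicalSpace N] [ChartedSpace F N]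

theorem hasMFDerivAt_restrictScalars {f : M → N} {x : M} {f' : E →L[ℂ] F}
    (h : HasMFDerivAt 𝓘(ℂ, E) 𝓘(ℂ, F) f x f') :
    HasMFDerivAt 𝓘(ℝ, E) 𝓘(ℝ, F) f x (f'.restrictScalars ℝ) := by
  have h2 : HasFDerivWithinAt (writtenInExtChartAt 𝓘(ℂ, E) 𝓘(ℂ, F) x f) (f' : E →L[ℂ] F)
      (Set.range 𝓘(ℂ, E)) (extChartAt 𝓘(ℂ, E) x x) := h.2
  exact ⟨h.1, h2.restrictScalars ℝ⟩

theorem contMDiff_restrictScalars {n : ℕ∞ω} {f : M → N} (h : ContMDiff 𝓘(ℂ, E) 𝓘(ℂ, F) n f) :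
    ContMDiff 𝓘(ℝ, E) 𝓘(ℝ, F) n f := by
  intro x
  have h1 := h x
  rw [contMDiffAt_iff] at h1 ⊢
  exact ⟨h1.1, h1.2.restrict_scalars ℝ⟩

theorem isManifold_restrictScalars {n : ℕ∞ω} [IsManifold 𝓘(ℂ, E) n M] :
    IsManifold 𝓘(ℝ, E) n M := by
  refine isManifold_of_contDiffOn _ _ _ fun e e' he he' => ?_
  have h := HasGroupoid.compatible (G := contDiffGroupoid n 𝓘(ℂ, E)) he he'
  rw [contDiffGroupoid, mem_groupoid_of_pregroupoid] at h
  exact ContDiffOn.restrict_scalars ℝ h.1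

theorem lieGroup_restrictScalars {n : ℕ∞ω} [Group M] [LieGroup 𝓘(ℂ, E) n M] :
    LieGroup 𝓘(ℝ, E) n M := by
  have : IsManifold 𝓘(ℝ, E) n M := isManifold_restrictScalars
  refine { contMDiff_mul := fun x => ?_,
           contMDiff_inv := contMDiff_restrictScalars (contMDiff_inv 𝓘(ℂ, E) n) }
  have h1 := (contMDiff_mul 𝓘(ℂ, E) n (G := M)) x
  rw [contMDiffAt_iff] at h1 ⊢
  exact ⟨h1.1, h1.2.restrict_scalars ℝ⟩

theorem mulInvariantVectorField_restrictScalars [Group M] [LieGroup 𝓘(ℂ, E) ω M] (v : E) (g : M) :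
    (mulInvariantVectorField (I := 𝓘(ℝ, E)) (G := M) v g : E) =
      (mulInvariantVectorField (I := 𝓘(ℂ, E)) (G := M) v g : E) := by
  have h : MDifferentiableAt 𝓘(ℂ, E) 𝓘(ℂ, E) (g * ·) (1 : M) :=
    (contMDiff_mul_left (I := 𝓘(ℂ, E)) (n := ω) (a := g)).mdifferentiable (by simp) 1
  have h2 := hasMFDerivAt_restrictScalars h.hasMFDerivAt
  exact congrArg (fun L : E →L[ℝ] E => L v) h2.mfderiv

end RestrictScalars

/-- Tangent spaces depend on the base point, which blocks rewriting. With derivatives typed on the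
model spaces, function and derivative can be replaced together. -/
theorem hasMFDerivAt_congr {𝕜 : Type*} [NontriviallyNormedField 𝕜]
    {E : Type*} [NormedAddCommGroup E] [NormedSpace 𝕜 E]
    {M : Type*} [TopologicalSpace M] [ChartedSpace E M]
    {F : Type*} [NormedAddCommGroup F] [NormedSpace 𝕜 F]
    {N : Type*} [TopologicalSpace N] [ChartedSpace F N]
    {f g : M → N} {x : M} {f' g' : E →L[𝕜] F} (h : HasMFDerivAt 𝓘(𝕜, E) 𝓘(𝕜, F) f x f')
    (hfg : f = g) (hfg' : f' = g') : HasMFDerivAt 𝓘(𝕜, E) 𝓘(𝕜, F) g x g' := by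
  subst hfg hfg'
  exact h

/-! ### One-parameter subgroups. -/

section OneParameter

variable {𝕜 : Type*} [NontriviallyNormedField 𝕜]
  {E : Type*} [NormedAddCommGroup E] [NormedSpace 𝕜 E]
  {G : Type*} [TopologicalSpace G] [ChartedSpace E G] [Group G]

/-- `γ : 𝕜 → G` is a homomorphism with velocity `v` at `0`, read in the preferred chart at `1`. -/
structure IsOneParameterSubgroup (v : E) (γ : 𝕜 → G) : Prop where
  map_add : ∀ s t, γ (s + t) = γ s * γ t
  continuousAt : ContinuousAt γ 0
  hasDerivAt : HasDerivAt (fun t => chartAt E (1 : G) (γ t)) v 0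

theorem IsOneParameterSubgroup.map_zero {v : E} {γ : 𝕜 → G} (h : IsOneParameterSubgroup v γ) :
    γ 0 = 1 := by
  simpa using h.map_add 0 0

theorem hasMFDerivAt_zero_iff {γ : 𝕜 → G} (h0 : γ 0 = 1) (v : E) :
    HasMFDerivAt 𝓘(𝕜, 𝕜) 𝓘(𝕜, E) γ 0 ((1 : 𝕜 →L[𝕜] 𝕜).smulRight v : 𝕜 →L[𝕜] E) ↔
      ContinuousAt γ 0 ∧ HasDerivAt (fun t => chartAt E (1 : G) (γ t)) v 0 := by
  rw [hasDerivAt_iff_hasFDerivAt, ← hasFDerivWithinAt_univ]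
  unfold HasMFDerivAt
  simp only [writtenInExtChartAt, h0, mfld_simps]
  rw [ContinuousLinearMap.smulRight_one_eq_toSpanSingleton]
  rfl

theorem IsOneParameterSubgroup.hasMFDerivAt_zero {v : E} {γ : 𝕜 → G}
    (h : IsOneParameterSubgroup v γ) :
    HasMFDerivAt 𝓘(𝕜, 𝕜) 𝓘(𝕜, E) γ 0 ((1 : 𝕜 →L[𝕜] 𝕜).smulRight v : 𝕜 →L[𝕜] E) :=
  (hasMFDerivAt_zero_iff h.map_zero v).2 ⟨h.continuousAt, h.hasDerivAt⟩

theorem IsOneParameterSubgroup.velocity_unique {v w : E} {γ : 𝕜 → G}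
    (h : IsOneParameterSubgroup v γ) (h' : IsOneParameterSubgroup w γ) : v = w :=
  h.hasDerivAt.unique h'.hasDerivAt

theorem IsOneParameterSubgroup.comp_mul {v : E} {γ : 𝕜 → G}
    (h : IsOneParameterSubgroup v γ) (c : 𝕜) :
    IsOneParameterSubgroup (c • v) (fun t => γ (c * t)) where
  map_add s t := by rw [mul_add, h.map_add]
  continuousAt := ContinuousAt.comp (f := fun t : 𝕜 => c * t) (g := γ)
    (by simpa using h.continuousAt) (by fun_prop)
  hasDerivAt := by
    have h1 : HasDerivAt (fun t : 𝕜 => c * t) c 0 := by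
      simpa using (hasDerivAt_id (0 : 𝕜)).const_mul c
    refine HasDerivAt.scomp (h := fun t : 𝕜 => c * t) (h' := c)
      (g₁ := fun t => chartAt E (1 : G) (γ t)) 0 ?_ h1
    simpa using h.hasDerivAt

/-- Homomorphisms which are differentiable at `1` map one-parameter subgroups to one-parameter
subgroups. -/
theorem IsOneParameterSubgroup.map {F : Type*} [NormedAddCommGroup F] [NormedSpace 𝕜 F]
    {H : Type*} [TopologicalSpace H] [ChartedSpace F H] [Group H] {φ : G →* H} {φ' : E →L[𝕜] F}
    (hφ : HasMFDerivAt 𝓘(𝕜, E) 𝓘(𝕜, F) φ 1 φ') {v : E} {γ : 𝕜 → G}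
    (h : IsOneParameterSubgroup v γ) : IsOneParameterSubgroup (φ' v) (fun t => φ (γ t)) := by
  have h3 := h.hasMFDerivAt_zero
  have h0 := h.map_zero
  have hc : HasMFDerivAt 𝓘(𝕜, 𝕜) 𝓘(𝕜, F) (fun t => φ (γ t)) 0
      ((1 : 𝕜 →L[𝕜] 𝕜).smulRight (φ' v) : 𝕜 →L[𝕜] F) := by
    rw [← h0] at hφ
    refine hasMFDerivAt_congr (hφ.comp (0 : 𝕜) h3) rfl ?_
    ext
    change φ' ((1 : 𝕜) • v) = (1 : 𝕜) • φ' v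
    simp
  obtain ⟨h5, h6⟩ := (hasMFDerivAt_zero_iff (by simp [h0]) (φ' v)).1 hc
  exact ⟨fun s t => by simp [h.map_add], h5, h6⟩

variable [LieGroup 𝓘(𝕜, E) 1 G]

/-- Differentiate `γ s = γ t * γ (s - t)` at `s = t`: the velocity at `t` is the left translate of
the velocity at `0`. -/
theorem IsOneParameterSubgroup.isOneParameterCurve {v : E} {γ : 𝕜 → G}
    (h : IsOneParameterSubgroup v γ) : IsOneParameterCurve (𝕜 := 𝕜) (E := E) v γ := by
  refine ⟨h.map_zero, fun t => ?_⟩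
  have h1 : HasMFDerivAt 𝓘(𝕜, 𝕜) 𝓘(𝕜, 𝕜) (fun s : 𝕜 => s - t) t
      (ContinuousLinearMap.id 𝕜 𝕜) :=
    hasMFDerivAt_iff_hasFDerivAt.2 ((hasFDerivAt_id t).sub_const t)
  obtain ⟨L, hL⟩ : ∃ L : E →L[𝕜] E, L = mfderiv 𝓘(𝕜, E) 𝓘(𝕜, E) (γ t * ·) (1 : G) := ⟨_, rfl⟩
  have h2 : HasMFDerivAt 𝓘(𝕜, E) 𝓘(𝕜, E) (γ t * ·) (1 : G) L := hL ▸
    ((contMDiff_mul_left (I := 𝓘(𝕜, E)) (n := 1) (a := γ t)).mdifferentiable (by simp)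
      1).hasMFDerivAt
  have h3 := h.hasMFDerivAt_zero
  have e0 : (fun s : 𝕜 => s - t) t = 0 := sub_self t
  rw [← h.map_zero] at h2
  rw [← e0] at h2 h3
  have h4 := HasMFDerivAt.comp (g := (γ t * ·)) t h2
    (HasMFDerivAt.comp (f := fun s : 𝕜 => s - t) t h3 h1)
  refine hasMFDerivAt_congr h4 ?_ ?_
  · funext s
    simp [← h.map_add]
  · change _ = ((1 : 𝕜 →L[𝕜] 𝕜).smulRight
      ((mfderiv 𝓘(𝕜, E) 𝓘(𝕜, E) (γ t * ·) (1 : G) : E →L[𝕜] E) v))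
    rw [← hL]
    ext
    change L ((1 : 𝕜) • v) = (1 : 𝕜) • L v
    simp

end OneParameter

/-! ### Left translation of integral curves. -/

section Translation

variable {𝕜 : Type*} [NontriviallyNormedField 𝕜]
  {E : Type*} [NormedAddCommGroup E] [NormedSpace 𝕜 E]
  {G : Type*} [TopologicalSpace G] [ChartedSpace E G] [Group G] [LieGroup 𝓘(𝕜, E) 1 G]

theorem mfderiv_mul_left_mulInvariantVectorField (v : GroupLieAlgebra 𝓘(𝕜, E) G) (g h : G) :
    mfderiv 𝓘(𝕜, E) 𝓘(𝕜, E) (g * ·) h (mulInvariantVectorField v h) =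
      mulInvariantVectorField v (g * h) := by
  have hd : ∀ g h : G, MDifferentiableAt 𝓘(𝕜, E) 𝓘(𝕜, E) (g * ·) h := fun g h =>
    (contMDiff_mul_left (I := 𝓘(𝕜, E)) (n := 1) (a := g)).mdifferentiable (by simp) h
  obtain ⟨L, hL⟩ : ∃ L : E →L[𝕜] E, L = mfderiv 𝓘(𝕜, E) 𝓘(𝕜, E) (g * ·) h := ⟨_, rfl⟩
  have h1 : HasMFDerivAt 𝓘(𝕜, E) 𝓘(𝕜, E) (g * ·) h L := hL ▸ (hd g h).hasMFDerivAt
  obtain ⟨L', hL'⟩ : ∃ L : E →L[𝕜] E, L = mfderiv 𝓘(𝕜, E) 𝓘(𝕜, E) (h * ·) (1 : G) := ⟨_, rfl⟩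
  have h2 : HasMFDerivAt 𝓘(𝕜, E) 𝓘(𝕜, E) (h * ·) (1 : G) L' := hL' ▸ (hd h 1).hasMFDerivAt
  have e0 : (h * ·) (1 : G) = h := mul_one h
  rw [← e0] at h1
  have h3 : HasMFDerivAt 𝓘(𝕜, E) 𝓘(𝕜, E) ((g * h) * ·) (1 : G) (L.comp L') := by
    refine hasMFDerivAt_congr (HasMFDerivAt.comp (g := (g * ·)) (1 : G) h1 h2) ?_ rfl
    funext x
    simp [mul_assoc]
  have h4 : (mfderiv 𝓘(𝕜, E) 𝓘(𝕜, E) ((g * h) * ·) (1 : G) : E →L[𝕜] E) = L.comp L' := h3.mfderiv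
  change (mfderiv 𝓘(𝕜, E) 𝓘(𝕜, E) (g * ·) h : E →L[𝕜] E)
    ((mfderiv 𝓘(𝕜, E) 𝓘(𝕜, E) (h * ·) (1 : G) : E →L[𝕜] E) v) =
    (mfderiv 𝓘(𝕜, E) 𝓘(𝕜, E) ((g * h) * ·) (1 : G) : E →L[𝕜] E) v
  rw [h4, ← hL, ← hL']
  rfl

omit [LieGroup 𝓘(𝕜, E) 1 G] in
theorem mulInvariantVectorField_one (v : GroupLieAlgebra 𝓘(𝕜, E) G) :
    (mulInvariantVectorField v (1 : G) : E) = v := by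
  have h : HasMFDerivAt 𝓘(𝕜, E) 𝓘(𝕜, E) ((1 : G) * ·) (1 : G) (ContinuousLinearMap.id 𝕜 E) := by
    refine hasMFDerivAt_congr (hasMFDerivAt_id (1 : G)) ?_ rfl
    funext x
    simp
  exact congrArg (fun L : E →L[𝕜] E => L v) h.mfderiv

theorem hasMFDerivWithinAt_mul_left_integralCurve {v : GroupLieAlgebra 𝓘(𝕜, E) G} {γ : 𝕜 → G}
    {s : Set 𝕜} {t : 𝕜} (g : G)
    (h : HasMFDerivWithinAt 𝓘(𝕜, 𝕜) 𝓘(𝕜, E) γ s t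
      ((1 : 𝕜 →L[𝕜] 𝕜).smulRight (mulInvariantVectorField v (γ t)))) :
    HasMFDerivWithinAt 𝓘(𝕜, 𝕜) 𝓘(𝕜, E) (fun t => g * γ t) s t
      ((1 : 𝕜 →L[𝕜] 𝕜).smulRight (mulInvariantVectorField v (g * γ t))) := by
  have h1 := ((contMDiff_mul_left (I := 𝓘(𝕜, E)) (n := 1) (a := g)).mdifferentiable (by simp)
    (γ t)).hasMFDerivAt
  have h2 := h1.comp_hasMFDerivWithinAt t h
  rw [← mfderiv_mul_left_mulInvariantVectorField]
  refine Eq.mpr (congrArg (fun L : 𝕜 →L[𝕜] E =>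
    HasMFDerivWithinAt 𝓘(𝕜, 𝕜) 𝓘(𝕜, E) (fun t => g * γ t) s t L) ?_) h2
  ext
  change (1 : 𝕜) • (mfderiv 𝓘(𝕜, E) 𝓘(𝕜, E) (g * ·) (γ t) : E →L[𝕜] E) _ =
    (mfderiv 𝓘(𝕜, E) 𝓘(𝕜, E) (g * ·) (γ t) : E →L[𝕜] E) ((1 : 𝕜) • _)
  simp only [one_smul]

theorem hasMFDerivAt_mul_left_integralCurve {v : GroupLieAlgebra 𝓘(𝕜, E) G} {γ : 𝕜 → G}
    {t : 𝕜} (g : G)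
    (h : HasMFDerivAt 𝓘(𝕜, 𝕜) 𝓘(𝕜, E) γ t
      ((1 : 𝕜 →L[𝕜] 𝕜).smulRight (mulInvariantVectorField v (γ t)))) :
    HasMFDerivAt 𝓘(𝕜, 𝕜) 𝓘(𝕜, E) (fun t => g * γ t) t
      ((1 : 𝕜 →L[𝕜] 𝕜).smulRight (mulInvariantVectorField v (g * γ t))) := by
  exact hasMFDerivWithinAt_univ.1 (hasMFDerivWithinAt_mul_left_integralCurve g
    (hasMFDerivWithinAt_univ.2 h))

omit [LieGroup 𝓘(𝕜, E) 1 G] in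
theorem IsOneParameterCurve.velocity {v : E} {γ : 𝕜 → G}
    (h : IsOneParameterCurve (𝕜 := 𝕜) (E := E) v γ) :
    HasMFDerivAt 𝓘(𝕜, 𝕜) 𝓘(𝕜, E) γ 0 ((1 : 𝕜 →L[𝕜] 𝕜).smulRight v : 𝕜 →L[𝕜] E) := by
  have h1 := h.2 0
  rw [h.1] at h1
  refine hasMFDerivAt_congr h1 rfl ?_
  exact congrArg (fun w : E => (1 : 𝕜 →L[𝕜] 𝕜).smulRight w) (mulInvariantVectorField_one v)

theorem IsOneParameterCurve.isOneParameterSubgroup {v : E} {γ : 𝕜 → G}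
    (h : IsOneParameterCurve (𝕜 := 𝕜) (E := E) v γ) (hadd : ∀ s t, γ (s + t) = γ s * γ t) :
    IsOneParameterSubgroup v γ :=
  ⟨hadd, (h.2 0).1, ((hasMFDerivAt_zero_iff h.1 v).1 h.velocity).2⟩

end Translation

/-! ### Existence and uniqueness of real one-parameter subgroups. -/

section Real

variable {E : Type*} [NormedAddCommGroup E] [NormedSpace ℝ E] [CompleteSpace E]
  {G : Type*} [TopologicalSpace G] [T2Space G] [ChartedSpace E G] [Group G]
  [LieGroup 𝓘(ℝ, E) ∞ G]

omit [CompleteSpace E] [T2Space G] in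
theorem contMDiff_one_mulInvariantVectorField (v : GroupLieAlgebra 𝓘(ℝ, E) G) :
    ContMDiff 𝓘(ℝ, E) 𝓘(ℝ, E).tangent 1
      (fun g : G => (⟨g, mulInvariantVectorField v g⟩ : TangentBundle 𝓘(ℝ, E) G)) :=
  (contMDiff_mulInvariantVectorField v).of_le (by simp)

omit [CompleteSpace E] in
theorem integralCurve_unique {v : GroupLieAlgebra 𝓘(ℝ, E) G} {γ γ' : ℝ → G}
    (h : IsMIntegralCurve (I := 𝓘(ℝ, E)) γ (mulInvariantVectorField v))
    (h' : IsMIntegralCurve (I := 𝓘(ℝ, E)) γ' (mulInvariantVectorField v)) (h0 : γ 0 = γ' 0) : γ = γ' :=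
  have : IsManifold 𝓘(ℝ, E) 1 G := IsManifold.of_le (n := ∞) (by simp)
  isMIntegralCurve_Ioo_eq_of_contMDiff_boundaryless
    (contMDiff_one_mulInvariantVectorField v) h h' h0

/-- As functions of `t`, both sides are integral curves of the same left-invariant field starting at
`γ s`. -/
theorem integralCurve_map_add {v : GroupLieAlgebra 𝓘(ℝ, E) G} {γ : ℝ → G} (h0 : γ 0 = 1)
    (h : IsMIntegralCurve (I := 𝓘(ℝ, E)) γ (mulInvariantVectorField v)) (s t : ℝ) :
    γ (s + t) = γ s * γ t := by
  have : LieGroup 𝓘(ℝ, E) 1 G := LieGroup.of_le (n := ∞) (by simp)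
  have h1 : IsMIntegralCurve (I := 𝓘(ℝ, E)) (fun t => γ s * γ t) (mulInvariantVectorField v) :=
    fun t => hasMFDerivAt_mul_left_integralCurve _ (h t)
  have h2 := integralCurve_unique (h.comp_add s) h1 (by simp [h0])
  have := congrFun h2 t
  simpa [add_comm] using this

/-- Left translates of a local integral curve through `1` give a curve through every point with the
same lifetime `ε`; this uniformity makes the field complete. -/
theorem exists_isOneParameterSubgroup (v : E) :
    ∃ γ : ℝ → G, IsOneParameterSubgroup v γ := by
  have : LieGroup 𝓘(ℝ, E) 1 G := LieGroup.of_le (n := ∞) (by simp)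
  have : IsManifold 𝓘(ℝ, E) 1 G := IsManifold.of_le (n := ∞) (by simp)
  have hV := contMDiff_one_mulInvariantVectorField (G := G) v
  obtain ⟨γ, h0, h⟩ := exists_isMIntegralCurveAt_of_contMDiffAt_boundaryless 0 (hV 1)
  rw [isMIntegralCurveAt_iff'] at h
  obtain ⟨ε, hε, h⟩ := h
  rw [Real.ball_eq_Ioo, zero_sub, zero_add] at h
  obtain ⟨η, hη0, hη⟩ := exists_isMIntegralCurve_of_isMIntegralCurveOn hV hε
    (fun x => ⟨fun t => x * γ t, by simp [h0],
      fun t ht => hasMFDerivWithinAt_mul_left_integralCurve x (h t ht)⟩) 1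
  exact ⟨η, IsOneParameterCurve.isOneParameterSubgroup ⟨hη0, hη⟩ (integralCurve_map_add hη0 hη)⟩

theorem IsOneParameterSubgroup.unique {v : E} {γ γ' : ℝ → G}
    (h : IsOneParameterSubgroup v γ) (h' : IsOneParameterSubgroup v γ') : γ = γ' :=
  have : LieGroup 𝓘(ℝ, E) 1 G := LieGroup.of_le (n := ∞) (by simp)
  integralCurve_unique h.isOneParameterCurve.2 h'.isOneParameterCurve.2
    (by rw [h.map_zero, h'.map_zero])

theorem IsOneParameterSubgroup.lieExp_eq {v : E} {γ : ℝ → G} (h : IsOneParameterSubgroup v γ) :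
    lieExp (𝕜 := ℝ) (E := E) v = γ 1 := by
  have : LieGroup 𝓘(ℝ, E) 1 G := LieGroup.of_le (n := ∞) (by simp)
  have hex : ∃ γ : ℝ → G, IsOneParameterCurve (𝕜 := ℝ) (E := E) v γ := ⟨γ, h.isOneParameterCurve⟩
  have h1 := hex.choose_spec
  refine (dif_pos hex).trans ?_
  rw [(h1.isOneParameterSubgroup (integralCurve_map_add h1.1 h1.2)).unique h]

end Real

/-! ### The adjoint representation. -/

section Adjoint

variable {𝕜 : Type*} [NontriviallyNormedField 𝕜]
  {E : Type*} [NormedAddCommGroup E] [NormedSpace 𝕜 E]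
  {G : Type*} [TopologicalSpace G] [ChartedSpace E G] [Group G]

variable (𝕜) in
/-- The adjoint representation of a Lie group on the model space of its Lie algebra. -/
def adjoint (g : G) : E →L[𝕜] E :=
  mfderiv 𝓘(𝕜, E) 𝓘(𝕜, E) (MulAut.conj g).toMonoidHom (1 : G)

variable [LieGroup 𝓘(𝕜, E) 1 G]

theorem hasMFDerivAt_conj (g : G) :
    HasMFDerivAt 𝓘(𝕜, E) 𝓘(𝕜, E) (MulAut.conj g).toMonoidHom (1 : G) (adjoint 𝕜 g : E →L[𝕜] E) := by
  have h : ContMDiff 𝓘(𝕜, E) 𝓘(𝕜, E) 1 (fun x : G => g * x * g⁻¹) :=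
    (contMDiff_mul_right (I := 𝓘(𝕜, E)) (n := 1) (a := g⁻¹)).comp
      (contMDiff_mul_left (I := 𝓘(𝕜, E)) (n := 1) (a := g))
  exact (h.mdifferentiable (by simp) 1).hasMFDerivAt

omit [LieGroup 𝓘(𝕜, E) 1 G] in
theorem adjoint_one : adjoint 𝕜 (1 : G) = ContinuousLinearMap.id 𝕜 E := by
  have h : HasMFDerivAt 𝓘(𝕜, E) 𝓘(𝕜, E) (MulAut.conj (1 : G)).toMonoidHom (1 : G)
      (ContinuousLinearMap.id 𝕜 E) := by
    refine hasMFDerivAt_congr (hasMFDerivAt_id (1 : G)) ?_ rfl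
    funext x
    simp
  exact h.mfderiv

theorem adjoint_mul (g h : G) : (adjoint 𝕜 (g * h) : E →L[𝕜] E) = (adjoint 𝕜 g).comp (adjoint 𝕜 h) := by
  have h1 : HasMFDerivAt 𝓘(𝕜, E) 𝓘(𝕜, E) (MulAut.conj (g * h)).toMonoidHom (1 : G)
      ((adjoint 𝕜 g).comp (adjoint 𝕜 h) : E →L[𝕜] E) := by
    have hg := hasMFDerivAt_conj (𝕜 := 𝕜) (E := E) g
    have hh := hasMFDerivAt_conj (𝕜 := 𝕜) (E := E) h
    rw [← map_one (MulAut.conj h).toMonoidHom] at hg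
    refine hasMFDerivAt_congr (HasMFDerivAt.comp (1 : G) hg hh) ?_ rfl
    funext x
    simp
  exact h1.mfderiv

theorem IsOneParameterSubgroup.conj {v : E} {γ : 𝕜 → G} (h : IsOneParameterSubgroup v γ) (g : G) :
    IsOneParameterSubgroup (adjoint 𝕜 g v) (fun t => g * γ t * g⁻¹) :=
  h.map (hasMFDerivAt_conj g)

end Adjoint

/-! ### The multiplication in a chart at the identity. -/

section ChartMul

variable {𝕜 : Type*} [NontriviallyNormedField 𝕜]
  {E : Type*} [NormedAddCommGroup E] [NormedSpace 𝕜 E]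
  (G : Type*) [TopologicalSpace G] [ChartedSpace E G] [Group G]

/-- The group multiplication read in the preferred chart at `1`. -/
def chartMul (p : E × E) : E :=
  chartAt E (1 : G) ((chartAt E (1 : G)).symm p.1 * (chartAt E (1 : G)).symm p.2)

theorem contDiffAt_chartMul {n : ℕ∞ω} [LieGroup 𝓘(𝕜, E) n G] :
    ContDiffAt 𝕜 n (chartMul (E := E) G) (chartAt E (1 : G) 1, chartAt E (1 : G) 1) := by
  have h := contMDiffAt_iff.1 ((contMDiff_mul 𝓘(𝕜, E) n (G := G)) (1, 1))
  have h2 := h.2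
  rw [ModelWithCorners.range_eq_univ, contDiffWithinAt_univ] at h2
  simp only [mul_one] at h2
  exact h2

theorem chartMul_chartAt_left {y : E} (hy : y ∈ (chartAt E (1 : G)).target) :
    chartMul G (chartAt E (1 : G) 1, y) = y := by
  simp [chartMul, hy]

theorem chartMul_chartAt_right {x : E} (hx : x ∈ (chartAt E (1 : G)).target) :
    chartMul G (x, chartAt E (1 : G) 1) = x := by
  simp [chartMul, hx]

theorem fderiv_chartMul_inl [LieGroup 𝓘(𝕜, E) 1 G] (w : E) :
    fderiv 𝕜 (chartMul (E := E) G) (chartAt E (1 : G) 1, chartAt E (1 : G) 1) (w, 0) = w := by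
  have h := ((contDiffAt_chartMul (𝕜 := 𝕜) (E := E) G (n := 1)).differentiableAt
    (by simp)).hasFDerivAt
  have h1 : HasFDerivAt (fun x : E => chartMul G (x, chartAt E (1 : G) 1)) _ (chartAt E (1 : G) 1) :=
    HasFDerivAt.comp (f := fun x : E => (x, chartAt E (1 : G) 1)) (chartAt E (1 : G) 1) h
      ((hasFDerivAt_id (𝕜 := 𝕜) (chartAt E (1 : G) 1)).prodMk (hasFDerivAt_const _ _))
  have h2 : HasFDerivAt (fun x : E => chartMul G (x, chartAt E (1 : G) 1))
      (ContinuousLinearMap.id 𝕜 E) (chartAt E (1 : G) 1) :=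
    (hasFDerivAt_id _).congr_of_eventuallyEq (Filter.eventually_of_mem
      ((chartAt E (1 : G)).open_target.mem_nhds (by simp)) fun x hx => chartMul_chartAt_right G hx)
  simpa using congrArg (fun L : E →L[𝕜] E => L w) (h1.unique h2)

theorem fderiv_chartMul_inr [LieGroup 𝓘(𝕜, E) 1 G] (w : E) :
    fderiv 𝕜 (chartMul (E := E) G) (chartAt E (1 : G) 1, chartAt E (1 : G) 1) (0, w) = w := by
  have h := ((contDiffAt_chartMul (𝕜 := 𝕜) (E := E) G (n := 1)).differentiableAt
    (by simp)).hasFDerivAt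
  have h1 : HasFDerivAt (fun x : E => chartMul G (chartAt E (1 : G) 1, x)) _ (chartAt E (1 : G) 1) :=
    h.comp (chartAt E (1 : G) 1)
      ((hasFDerivAt_const _ _).prodMk (hasFDerivAt_id (𝕜 := 𝕜) (chartAt E (1 : G) 1)))
  have h2 : HasFDerivAt (fun x : E => chartMul G (chartAt E (1 : G) 1, x))
      (ContinuousLinearMap.id 𝕜 E) (chartAt E (1 : G) 1) :=
    (hasFDerivAt_id _).congr_of_eventuallyEq (Filter.eventually_of_mem
      ((chartAt E (1 : G)).open_target.mem_nhds (by simp)) fun x hx => chartMul_chartAt_left G hx)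
  simpa using congrArg (fun L : E →L[𝕜] E => L w) (h1.unique h2)

variable {G}

/-- Differentiating `g x = (g x g⁻¹) g` in `x` at `1`. -/
theorem fderiv_chartMul_adjoint [LieGroup 𝓘(𝕜, E) 1 G] {g : G} (hg : g ∈ (chartAt E (1 : G)).source)
    (h1 : DifferentiableAt 𝕜 (chartMul (E := E) G) (chartAt E (1 : G) g, chartAt E (1 : G) 1))
    (h2 : DifferentiableAt 𝕜 (chartMul (E := E) G) (chartAt E (1 : G) 1, chartAt E (1 : G) g))
    (w : E) :
    fderiv 𝕜 (chartMul (E := E) G) (chartAt E (1 : G) g, chartAt E (1 : G) 1) (0, w) =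
      fderiv 𝕜 (chartMul (E := E) G) (chartAt E (1 : G) 1, chartAt E (1 : G) g)
        (adjoint 𝕜 g w, 0) := by
  set φ := chartAt E (1 : G) with hφ
  have hA := hasMFDerivAt_conj (𝕜 := 𝕜) (E := E) g
  have hψ : HasFDerivAt (fun y : E => φ (g * φ.symm y * g⁻¹)) (adjoint 𝕜 g) (φ 1) := by
    have h := hA.2
    simp only [writtenInExtChartAt, map_one, mfld_simps] at h
    exact hasFDerivWithinAt_univ.1 h
  have hψ1 : φ (g * φ.symm (φ 1) * g⁻¹) = φ 1 := by simp [hφ]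
  have hl : HasFDerivAt (fun y : E => chartMul G (φ g, y)) _ (φ 1) :=
    h1.hasFDerivAt.comp (φ 1) ((hasFDerivAt_const _ _).prodMk (hasFDerivAt_id (𝕜 := 𝕜) (φ 1)))
  rw [← hψ1] at h2
  have hr : HasFDerivAt (fun y : E => chartMul G (φ (g * φ.symm y * g⁻¹), φ g)) _ (φ 1) :=
    HasFDerivAt.comp (f := fun y : E => (φ (g * φ.symm y * g⁻¹), φ g)) (φ 1) h2.hasFDerivAt
      (hψ.prodMk (hasFDerivAt_const _ _))
  have hev : (fun y : E => chartMul G (φ g, y)) =ᶠ[nhds (φ 1)]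
      fun y : E => chartMul G (φ (g * φ.symm y * g⁻¹), φ g) := by
    have hc : ContinuousAt (fun y : E => g * φ.symm y * g⁻¹) (φ 1) := by
      have h3 : ContinuousAt (MulAut.conj g).toMonoidHom (φ.symm (φ 1)) := by
        simpa [hφ] using hA.1
      exact ContinuousAt.comp (f := φ.symm) (g := (MulAut.conj g).toMonoidHom) h3
        (φ.continuousAt_symm (by simp [hφ]))
    have hs : φ.source ∈ nhds (g * φ.symm (φ 1) * g⁻¹) := by
      apply φ.open_source.mem_nhds
      simp [hφ]
    filter_upwards [hc hs] with y hy
    have hy' : g * φ.symm y * g⁻¹ ∈ φ.source := hy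
    simp only [chartMul, ← hφ]
    rw [φ.left_inv hg, φ.left_inv hy']
    simp
  have := congrArg (fun L : E →L[𝕜] E => L w) ((hr.congr_of_eventuallyEq hev).unique hl)
  simp only [hψ1] at this
  simpa using this.symm

end ChartMul

/-! ### Commuting one-parameter subgroups. -/

section Commute

variable {E : Type*} [NormedAddCommGroup E] [NormedSpace ℝ E]
  {G : Type*} [TopologicalSpace G] [ChartedSpace E G] [Group G] [LieGroup 𝓘(ℝ, E) ∞ G]

variable (G) in
/-- The mixed second derivative of the multiplication at the identity, read in a chart. Its
antisymmetrization is the Lie bracket. -/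
def mixedDeriv (v w : E) : E :=
  fderiv ℝ (fderiv ℝ (chartMul (E := E) G)) (chartAt E (1 : G) 1, chartAt E (1 : G) 1) (v, 0) (0, w)

/-- Write `m` for the multiplication in the chart. By `fderiv_chartMul_adjoint`, `D₂m(γ t, 1) w -
D₁m(1, γ t) w = D₁m(1, γ t)(Ad(γ t) w - w)`. The left side vanishes at `0` with derivative
`mixedDeriv v w - mixedDeriv w v = 0`, so it is `o(t)`. As `D₁m(1, γ t)` is close to the identity,
`Ad(γ t) w - w` is `o(t)` too; differentiability of `Ad` need not be known beforehand. -/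
theorem hasDerivAt_adjoint_zero {v w : E} {γ : ℝ → G} (h : IsOneParameterSubgroup v γ)
    (hvw : mixedDeriv G v w = mixedDeriv G w v) :
    HasDerivAt (fun t => adjoint ℝ (γ t) w) 0 0 := by
  have : LieGroup 𝓘(ℝ, E) 1 G := LieGroup.of_le (n := ∞) (by simp)
  set φ := chartAt E (1 : G) with hφ
  set m := chartMul (E := E) G with hm
  have hm2 : ContDiffAt ℝ 2 m (φ 1, φ 1) :=
    (contDiffAt_chartMul (n := ∞) G).of_le ENat.LEInfty.out
  have hD : HasFDerivAt (fderiv ℝ m) (fderiv ℝ (fderiv ℝ m) (φ 1, φ 1)) (φ 1, φ 1) :=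
    ((hm2.fderiv_right (m := 1) (by norm_num)).differentiableAt (by simp)).hasFDerivAt
  have hsymm := hm2.isSymmSndFDerivAt (by simp)
  have hc0 : φ (γ 0) = φ 1 := by rw [h.map_zero]
  have hc := h.hasDerivAt
  rw [← hφ] at hc
  have hcl : HasDerivAt (fun t => (φ (γ t), φ 1)) (v, (0 : E)) 0 := hc.prodMk (hasDerivAt_const _ _)
  have hcr : HasDerivAt (fun t => (φ 1, φ (γ t))) ((0 : E), v) 0 := (hasDerivAt_const _ _).prodMk hc
  have hDl : HasDerivAt (fun t => fderiv ℝ m (φ (γ t), φ 1)) _ 0 :=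
    HasFDerivAt.comp_hasDerivAt (l := fderiv ℝ m) (f := fun t => (φ (γ t), φ 1)) 0
      (by rw [hc0]; exact hD) hcl
  have hDr : HasDerivAt (fun t => fderiv ℝ m (φ 1, φ (γ t))) _ 0 :=
    HasFDerivAt.comp_hasDerivAt (l := fderiv ℝ m) (f := fun t => (φ 1, φ (γ t))) 0
      (by rw [hc0]; exact hD) hcr
  have hd : HasDerivAt (fun t => fderiv ℝ m (φ (γ t), φ 1) (0, w) - fderiv ℝ m (φ 1, φ (γ t)) (w, 0))
      0 0 := by
    have h1 := hDl.clm_apply (hasDerivAt_const (0 : ℝ) ((0 : E), w))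
    have h2 := hDr.clm_apply (hasDerivAt_const (0 : ℝ) (w, (0 : E)))
    have h3 := hsymm (0, v) (w, 0)
    have h4 : fderiv ℝ (fderiv ℝ m) (φ 1, φ 1) (v, 0) (0, w) =
      fderiv ℝ (fderiv ℝ m) (φ 1, φ 1) (w, 0) (0, v) := hvw
    convert h1.sub h2 using 1
    · rfl
    · rw [map_zero, map_zero, add_zero, add_zero, h3, h4, sub_self]
  have hdiff : ∀ᶠ p in nhds (φ 1, φ 1), DifferentiableAt ℝ m p :=
    ((hm2.of_le (m := 1) (by norm_num)).eventually (by simp)).mono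
      fun p hp => hp.differentiableAt (by simp)
  have hsrc : ∀ᶠ t in nhds (0 : ℝ), γ t ∈ φ.source := by
    apply h.continuousAt
    rw [h.map_zero]
    exact φ.open_source.mem_nhds (by simp [hφ])
  have hkey : ∀ᶠ t in nhds (0 : ℝ), fderiv ℝ m (φ (γ t), φ 1) (0, w) =
      fderiv ℝ m (φ 1, φ (γ t)) (adjoint ℝ (γ t) w, 0) := by
    have t1 := hcl.continuousAt.tendsto
    have t2 := hcr.continuousAt.tendsto
    rw [hc0] at t1 t2
    filter_upwards [hsrc, t1.eventually hdiff, t2.eventually hdiff] with t h0 h1 h2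
    exact fderiv_chartMul_adjoint h0 h1 h2 w
  -- Distance at most `1 / 2` from the identity on the first factor bounds the inverse by the
  -- constant `2` of `hbound`.
  have hnear : ∀ᶠ t in nhds (0 : ℝ),
      ‖(fderiv ℝ m (φ 1, φ (γ t))) - fderiv ℝ m (φ 1, φ 1)‖ < 1 / 2 := by
    have := hDr.continuousAt.tendsto
    rw [hc0] at this
    have := (tendsto_iff_norm_sub_tendsto_zero.1 this).eventually (gt_mem_nhds (by norm_num : (0:ℝ) < 1/2))
    exact this
  have hbound : ∀ᶠ t in nhds (0 : ℝ), ‖adjoint ℝ (γ t) w - w‖ ≤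
      2 * ‖fderiv ℝ m (φ (γ t), φ 1) (0, w) - fderiv ℝ m (φ 1, φ (γ t)) (w, 0)‖ := by
    filter_upwards [hkey, hnear] with t h1 h2
    set x := adjoint ℝ (γ t) w - w with hx
    have e1 : fderiv ℝ m (φ (γ t), φ 1) (0, w) - fderiv ℝ m (φ 1, φ (γ t)) (w, 0) =
        fderiv ℝ m (φ 1, φ (γ t)) (x, 0) := by
      rw [h1, ← map_sub]
      simp [hx]
    rw [e1]
    have e2 : x = fderiv ℝ m (φ 1, φ (γ t)) (x, 0) -
        (fderiv ℝ m (φ 1, φ (γ t)) - fderiv ℝ m (φ 1, φ 1)) (x, 0) := by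
      have := fderiv_chartMul_inl (𝕜 := ℝ) G x
      simp only [sub_apply]
      rw [sub_sub_cancel]
      exact this.symm
    have e3 : ‖(fderiv ℝ m (φ 1, φ (γ t)) - fderiv ℝ m (φ 1, φ 1)) (x, 0)‖ ≤ 1 / 2 * ‖x‖ := by
      refine (ContinuousLinearMap.le_opNorm _ _).trans ?_
      have : ‖(x, (0 : E))‖ = ‖x‖ := by simp [Prod.norm_def]
      rw [this]
      gcongr
    have e4 := norm_sub_le (fderiv ℝ m (φ 1, φ (γ t)) (x, 0))
      ((fderiv ℝ m (φ 1, φ (γ t)) - fderiv ℝ m (φ 1, φ 1)) (x, 0))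
    rw [← e2] at e4
    linarith
  have hd0 : fderiv ℝ m (φ (γ 0), φ 1) (0, w) - fderiv ℝ m (φ 1, φ (γ 0)) (w, 0) = 0 := by
    rw [hc0, sub_eq_zero]
    exact (fderiv_chartMul_inr (𝕜 := ℝ) G w).trans (fderiv_chartMul_inl (𝕜 := ℝ) G w).symm
  rw [hasDerivAt_iff_isLittleO_nhds_zero] at hd ⊢
  simp only [zero_add, smul_zero, sub_zero, hd0] at hd ⊢
  have h0 : adjoint ℝ (γ 0) w = w := by rw [h.map_zero, adjoint_one]; rfl
  rw [h0]
  refine Asymptotics.IsBigO.trans_isLittleO (Asymptotics.IsBigO.of_bound 2 hbound) hd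

/-- Since `Ad(γ s) = Ad(γ t) Ad(γ (s - t))`, the vanishing derivative at `0` propagates to every
`t`, and the curve is constant. -/
theorem adjoint_eq_self {v w : E} {γ : ℝ → G} (h : IsOneParameterSubgroup v γ)
    (hvw : mixedDeriv G v w = mixedDeriv G w v) (t : ℝ) : adjoint ℝ (γ t) w = w := by
  have : LieGroup 𝓘(ℝ, E) 1 G := LieGroup.of_le (n := ∞) (by simp)
  have hder : ∀ t, HasDerivAt (fun t => adjoint ℝ (γ t) w) 0 t := by
    intro t
    have h1 := hasDerivAt_adjoint_zero h hvw
    have h2 : HasDerivAt (fun s : ℝ => s - t) 1 t := (hasDerivAt_id t).sub_const t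
    have h3 : HasDerivAt (fun s => adjoint ℝ (γ (s - t)) w) ((1 : ℝ) • (0 : E)) t :=
      HasDerivAt.scomp (g₁ := fun s => adjoint ℝ (γ s) w) (h := fun s : ℝ => s - t) t
        (by simpa using h1) h2
    have h4 : HasDerivAt (fun s => adjoint ℝ (γ t) (adjoint ℝ (γ (s - t)) w))
        (adjoint ℝ (γ t) ((1 : ℝ) • (0 : E))) t :=
      (adjoint ℝ (γ t) : E →L[ℝ] E).hasFDerivAt.comp_hasDerivAt t h3
    convert h4 using 1
    · funext s
      rw [← ContinuousLinearMap.comp_apply, ← adjoint_mul, ← h.map_add]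
      simp
    · simp
  have := is_const_of_deriv_eq_zero (fun t => (hder t).differentiableAt) (fun t => (hder t).deriv) t 0
  rw [this, h.map_zero, adjoint_one]
  rfl

/-- Conjugating `η` by `γ s` gives a one-parameter subgroup with velocity `Ad(γ s) w = w`, which is
`η` again by uniqueness. -/
theorem commute_of_mixedDeriv_eq [CompleteSpace E] [T2Space G] {v w : E} {γ η : ℝ → G}
    (h : IsOneParameterSubgroup v γ) (h' : IsOneParameterSubgroup w η)
    (hvw : mixedDeriv G v w = mixedDeriv G w v) (s t : ℝ) : Commute (γ s) (η t) := by
  have : LieGroup 𝓘(ℝ, E) 1 G := LieGroup.of_le (n := ∞) (by simp)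
  have h1 := h'.conj (γ s)
  rw [adjoint_eq_self h hvw] at h1
  have h2 := congrFun (h1.unique h') t
  exact mul_inv_eq_iff_eq_mul.1 h2

end Commute

/-! ### The Lie bracket as an antisymmetrized second derivative. -/

section Bracket

open VectorField

variable {E : Type*} [NormedAddCommGroup E] [NormedSpace ℝ E]
  {G : Type*} [TopologicalSpace G] [ChartedSpace E G] [Group G] [LieGroup 𝓘(ℝ, E) ∞ G]

/-- The map `y ↦ chartMul G (x, y)` is left translation by the point with coordinate `x`, read in
the chart; the chain rule then gives the left-invariant field in coordinates. -/
theorem mpullbackWithin_mulInvariantVectorField_eq (v : GroupLieAlgebra 𝓘(ℝ, E) G) {x : E}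
    (hx : x ∈ (chartAt E (1 : G)).target)
    (hd : DifferentiableAt ℝ (chartMul (E := E) G) (x, chartAt E (1 : G) 1)) :
    (mpullbackWithin 𝓘(ℝ, E) 𝓘(ℝ, E) (extChartAt 𝓘(ℝ, E) (1 : G)).symm
      (mulInvariantVectorField v) (Set.range 𝓘(ℝ, E)) x : E) =
      fderiv ℝ (chartMul (E := E) G) (x, chartAt E (1 : G) 1) (0, (v : E)) := by
  have : LieGroup 𝓘(ℝ, E) 1 G := LieGroup.of_le (n := ∞) (by simp)
  have : IsManifold 𝓘(ℝ, E) 1 G := IsManifold.of_le (n := ∞) (by simp)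
  set φ := chartAt E (1 : G) with hφ
  have hx' : x ∈ (extChartAt 𝓘(ℝ, E) (1 : G)).target := by simpa using hx
  have hinv := ContinuousLinearMap.inverse_eq
    (mfderivWithin_extChartAt_symm_comp_mfderiv_extChartAt hx')
    (mfderiv_extChartAt_comp_mfderivWithin_extChartAt_symm hx')
  rw [mpullbackWithin, hinv]
  set g : G := φ.symm x with hg
  have hgs : g ∈ φ.source := φ.map_target hx
  obtain ⟨L, hL⟩ : ∃ L : E →L[ℝ] E, L = mfderiv 𝓘(ℝ, E) 𝓘(ℝ, E) (g * ·) (1 : G) := ⟨_, rfl⟩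
  have h1 : HasMFDerivAt 𝓘(ℝ, E) 𝓘(ℝ, E) (g * ·) (1 : G) L := hL ▸
    ((contMDiff_mul_left (I := 𝓘(ℝ, E)) (n := 1) (a := g)).mdifferentiable (by simp)
      1).hasMFDerivAt
  obtain ⟨L', hL'⟩ : ∃ L' : E →L[ℝ] E,
    L' = mfderiv 𝓘(ℝ, E) 𝓘(ℝ, E) (extChartAt 𝓘(ℝ, E) (1 : G)) g := ⟨_, rfl⟩
  have h2 : HasMFDerivAt 𝓘(ℝ, E) 𝓘(ℝ, E) (extChartAt 𝓘(ℝ, E) (1 : G)) g L' := hL' ▸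
    (mdifferentiableAt_extChartAt (I := 𝓘(ℝ, E)) hgs).hasMFDerivAt
  have e0 : (g * ·) (1 : G) = g := mul_one g
  rw [← e0] at h2
  have h3 := (HasMFDerivAt.comp (g := extChartAt 𝓘(ℝ, E) (1 : G)) (1 : G) h2 h1).2
  simp only [writtenInExtChartAt, mfld_simps] at h3
  have h4 : HasFDerivAt (fun y : E => chartMul G (x, y)) (L'.comp L) (φ 1) :=
    hasFDerivWithinAt_univ.1 h3
  have h5 : HasFDerivAt (fun y : E => chartMul G (x, y)) _ (φ 1) :=
    hd.hasFDerivAt.comp (φ 1) ((hasFDerivAt_const _ _).prodMk (hasFDerivAt_id (𝕜 := ℝ) (φ 1)))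
  have h6 := congrArg (fun L : E →L[ℝ] E => L v) (h4.unique h5)
  change (mfderiv 𝓘(ℝ, E) 𝓘(ℝ, E) (extChartAt 𝓘(ℝ, E) (1 : G)) g : E →L[ℝ] E)
    ((mfderiv 𝓘(ℝ, E) 𝓘(ℝ, E) (g * ·) (1 : G) : E →L[ℝ] E) v) = _
  rw [← hL, ← hL']
  exact h6

theorem bracket_eq_mixedDeriv_sub (v w : GroupLieAlgebra 𝓘(ℝ, E) G) :
    (⁅v, w⁆ : GroupLieAlgebra 𝓘(ℝ, E) G) = mixedDeriv (E := E) G v w - mixedDeriv (E := E) G w v := by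
  have : LieGroup 𝓘(ℝ, E) 1 G := LieGroup.of_le (n := ∞) (by simp)
  have : IsManifold 𝓘(ℝ, E) 1 G := IsManifold.of_le (n := ∞) (by simp)
  set φ := chartAt E (1 : G) with hφ
  set m := chartMul (E := E) G with hm
  have hm2 : ContDiffAt ℝ 2 m (φ 1, φ 1) :=
    (contDiffAt_chartMul (n := ∞) G).of_le ENat.LEInfty.out
  have hD : HasFDerivAt (fderiv ℝ m) (fderiv ℝ (fderiv ℝ m) (φ 1, φ 1)) (φ 1, φ 1) :=
    ((hm2.fderiv_right (m := 1) (by norm_num)).differentiableAt (by simp)).hasFDerivAt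
  have hdiff : ∀ᶠ p in nhds (φ 1, φ 1), DifferentiableAt ℝ m p :=
    ((hm2.of_le (m := 1) (by norm_num)).eventually (by simp)).mono
      fun p hp => hp.differentiableAt (by simp)
  have hdiff' : ∀ᶠ x in nhds (φ 1), DifferentiableAt ℝ m (x, φ 1) :=
    (Continuous.tendsto (by fun_prop : Continuous fun x : E => (x, φ 1)) (φ 1)).eventually hdiff
  have htgt : ∀ᶠ x in nhds (φ 1), x ∈ φ.target := φ.open_target.mem_nhds (by simp [hφ])
  have hV : ∀ v : GroupLieAlgebra 𝓘(ℝ, E) G,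
      (mpullbackWithin 𝓘(ℝ, E) 𝓘(ℝ, E) (extChartAt 𝓘(ℝ, E) (1 : G)).symm
      (mulInvariantVectorField v) (Set.range 𝓘(ℝ, E)) : E → E) =ᶠ[nhds (φ 1)]
      fun x => fderiv ℝ m (x, φ 1) (0, (v : E)) := by
    intro v
    filter_upwards [hdiff', htgt] with x h1 h2
    exact mpullbackWithin_mulInvariantVectorField_eq v h2 h1
  have hder : ∀ u z : E, fderiv ℝ (fun x => fderiv ℝ m (x, φ 1) (0, z)) (φ 1) u =
      mixedDeriv G u z := by
    intro u z
    have h1 : HasFDerivAt (fun x : E => fderiv ℝ m (x, φ 1)) _ (φ 1) :=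
      HasFDerivAt.comp (f := fun x : E => (x, φ 1)) (φ 1) hD
        ((hasFDerivAt_id (𝕜 := ℝ) (φ 1)).prodMk (hasFDerivAt_const _ _))
    have h2 := h1.clm_apply (hasFDerivAt_const ((0 : E), z) (φ 1))
    rw [h2.fderiv]
    simp [mixedDeriv, hm, hφ]
  have hb : ∀ (v w : E) (V W : E → E), V =ᶠ[nhds (φ 1)] (fun x => fderiv ℝ m (x, φ 1) (0, v)) →
      W =ᶠ[nhds (φ 1)] (fun x => fderiv ℝ m (x, φ 1) (0, w)) →
      lieBracketWithin ℝ V W Set.univ (φ 1) =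
        mixedDeriv (E := E) G v w - mixedDeriv (E := E) G w v := by
    intro v w V W hV hW
    rw [lieBracketWithin_univ, hV.lieBracket_vectorField_eq hW, lieBracket, hder, hder,
      fderiv_chartMul_inr, fderiv_chartMul_inr]
  -- The preferred chart has identity derivative at its base point, so the bracket computed in the
  -- chart needs no correction.
  have hid : (mfderiv 𝓘(ℝ, E) 𝓘(ℝ, E) (extChartAt 𝓘(ℝ, E) (1 : G)) (1 : G) : E →L[ℝ] E) =
    ContinuousLinearMap.id ℝ E := mfderiv_extChartAt_self
  have hset : (extChartAt 𝓘(ℝ, E) (1 : G)).symm ⁻¹' Set.univ ∩ Set.range 𝓘(ℝ, E) = Set.univ := by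
    simp
  have h := mlieBracketWithin_apply (I := 𝓘(ℝ, E)) (V := mulInvariantVectorField v)
    (W := mulInvariantVectorField w) (s := Set.univ) (x₀ := (1 : G))
  rw [mlieBracketWithin_univ, hset] at h
  have key : ∀ L : E →L[ℝ] E, L = ContinuousLinearMap.id ℝ E → ∀ x, L.inverse x = x := by
    rintro L rfl x
    simp
  exact h.trans ((key _ hid _).trans (hb _ _ _ _ (hV v) (hV w)))

end Bracket

/-! ### Products of one-parameter subgroups. -/

section Product

variable {𝕜 : Type*} [NontriviallyNormedField 𝕜]
  {E : Type*} [NormedAddCommGroup E] [NormedSpace 𝕜 E]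
  {G : Type*} [TopologicalSpace G] [ChartedSpace E G] [Group G] [LieGroup 𝓘(𝕜, E) 1 G]

/-- The derivative of multiplication at `(1, 1)` is addition. -/
theorem hasFDerivAt_chartAt_mul {X : Type*} [NormedAddCommGroup X] [NormedSpace 𝕜 X]
    {f g : X → G} {x₀ : X} {f' g' : X →L[𝕜] E} (hf0 : f x₀ = 1) (hg0 : g x₀ = 1)
    (hfc : ContinuousAt f x₀) (hgc : ContinuousAt g x₀)
    (hf : HasFDerivAt (fun x => chartAt E (1 : G) (f x)) f' x₀)
    (hg : HasFDerivAt (fun x => chartAt E (1 : G) (g x)) g' x₀) :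
    HasFDerivAt (fun x => chartAt E (1 : G) (f x * g x)) (f' + g') x₀ := by
  set φ := chartAt E (1 : G) with hφ
  have hm := ((contDiffAt_chartMul (𝕜 := 𝕜) (E := E) G (n := 1)).differentiableAt
    (by simp)).hasFDerivAt
  have h0 : (φ (f x₀), φ (g x₀)) = (φ 1, φ 1) := by rw [hf0, hg0]
  rw [← hφ, ← h0] at hm
  have h1 : HasFDerivAt (fun x => chartMul G (φ (f x), φ (g x))) _ x₀ :=
    HasFDerivAt.comp (f := fun x => (φ (f x), φ (g x))) x₀ hm (hf.prodMk hg)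
  have hsf : ∀ᶠ x in nhds x₀, f x ∈ φ.source :=
    hfc (φ.open_source.mem_nhds (by simp [hφ, hf0]))
  have hsg : ∀ᶠ x in nhds x₀, g x ∈ φ.source :=
    hgc (φ.open_source.mem_nhds (by simp [hφ, hg0]))
  refine (h1.congr_of_eventuallyEq ?_).congr_fderiv ?_
  · filter_upwards [hsf, hsg] with x h2 h3
    simp [chartMul, ← hφ, h2, h3]
  · rw [h0]
    ext u
    have e1 := fderiv_chartMul_inl (𝕜 := 𝕜) G (f' u)
    have e2 := fderiv_chartMul_inr (𝕜 := 𝕜) G (g' u)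
    rw [← hφ] at e1 e2
    have e3 : ((f' u, g' u) : E × E) = (f' u, 0) + (0, g' u) := by simp
    rw [ContinuousLinearMap.comp_apply, ContinuousLinearMap.prod_apply, e3, map_add, e1, e2]
    rfl

theorem IsOneParameterSubgroup.mul {v w : E} {γ η : 𝕜 → G} (hγ : IsOneParameterSubgroup v γ)
    (hη : IsOneParameterSubgroup w η) (hc : ∀ s t, Commute (γ s) (η t)) :
    IsOneParameterSubgroup (v + w) (fun t => γ t * η t) where
  map_add s t := by
    rw [hγ.map_add, hη.map_add, mul_assoc, mul_assoc, ← mul_assoc (γ t), (hc t s).eq, mul_assoc]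
  continuousAt := by
    have := (contMDiff_mul 𝓘(𝕜, E) 1 (G := G)).continuous.tendsto (γ 0, η 0)
    exact this.comp (hγ.continuousAt.prodMk_nhds hη.continuousAt)
  hasDerivAt := by
    have := hasFDerivAt_chartAt_mul hγ.map_zero hη.map_zero hγ.continuousAt hη.continuousAt
      hγ.hasDerivAt.hasFDerivAt hη.hasDerivAt.hasFDerivAt
    rw [hasDerivAt_iff_hasFDerivAt]
    refine this.congr_fderiv ?_
    ext
    simp

end Product

/-! ### The real exponential map. -/

section RealExp

variable {E : Type*} [NormedAddCommGroup E] [NormedSpace ℝ E] [CompleteSpace E]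
  {G : Type*} [TopologicalSpace G] [T2Space G] [ChartedSpace E G] [Group G]
  [LieGroup 𝓘(ℝ, E) ∞ G]

theorem isOneParameterSubgroup_lieExp_real (v : GroupLieAlgebra 𝓘(ℝ, E) G) :
    IsOneParameterSubgroup (E := E) v (fun t : ℝ => (lieExp (t • v) : G)) := by
  obtain ⟨γ, hγ⟩ := exists_isOneParameterSubgroup (G := G) (E := E) v
  convert hγ using 1
  funext t
  refine ((hγ.comp_mul t).lieExp_eq).trans ?_
  simp

theorem commute_lieExp_of_bracket_eq_zero {v w : GroupLieAlgebra 𝓘(ℝ, E) G} (h : ⁅v, w⁆ = 0)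
    (s t : ℝ) : Commute (lieExp (s • v) : G) (lieExp (t • w)) := by
  refine commute_of_mixedDeriv_eq (isOneParameterSubgroup_lieExp_real v)
    (isOneParameterSubgroup_lieExp_real w) ?_ s t
  rw [bracket_eq_mixedDeriv_sub] at h
  exact sub_eq_zero.1 h

end RealExp

/-! ### The complex exponential map. -/

section Complex

variable {E : Type*} [NormedAddCommGroup E] [NormedSpace ℂ E]
  {G : Type*} [TopologicalSpace G] [ChartedSpace E G] [Group G]

theorem IsOneParameterSubgroup.comp_ofReal {v : E} {γ : ℂ → G} (h : IsOneParameterSubgroup v γ) :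
    IsOneParameterSubgroup v (fun t : ℝ => γ t) where
  map_add s t := by simp [h.map_add]
  continuousAt := ContinuousAt.comp (f := fun t : ℝ => (t : ℂ)) (g := γ)
    (by simpa using h.continuousAt) (by fun_prop)
  hasDerivAt := by
    have h1 : HasDerivAt (fun t => chartAt E (1 : G) (γ t)) v ((0 : ℝ) : ℂ) := by
      simpa using h.hasDerivAt
    have h2 : HasDerivAt (fun t : ℝ => (t : ℂ)) 1 0 := by
      simpa using (hasDerivAt_id (0 : ℝ)).ofReal_comp
    simpa [Function.comp_def] using HasDerivAt.scomp (h := fun t : ℝ => (t : ℂ)) (0 : ℝ) h1 h2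

variable [LieGroup 𝓘(ℂ, E) ω G]

/-- Real and complex derivatives of the holomorphic multiplication agree near the identity. This
makes `mixedDeriv` complex bilinear, hence symmetric on the pair `v`, `iv`. -/
theorem mixedDeriv_eq_complex (v w : E) :
    mixedDeriv G v w = fderiv ℂ (fderiv ℂ (chartMul (E := E) G))
      (chartAt E (1 : G) 1, chartAt E (1 : G) 1) (v, 0) (0, w) := by
  set φ := chartAt E (1 : G) with hφ
  set m := chartMul (E := E) G with hm
  have hm2 : ContDiffAt ℂ 2 m (φ 1, φ 1) :=
    (contDiffAt_chartMul (𝕜 := ℂ) (n := ω) G).of_le (by simp)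
  have hdiff : ∀ᶠ p in nhds (φ 1, φ 1), DifferentiableAt ℂ m p :=
    ((hm2.of_le (m := 1) (by norm_num)).eventually (by simp)).mono
      fun p hp => hp.differentiableAt (by simp)
  have hDC : DifferentiableAt ℂ (fderiv ℂ m) (φ 1, φ 1) :=
    (hm2.fderiv_right (m := 1) (by norm_num)).differentiableAt (by simp)
  have hDR : DifferentiableAt ℝ (fderiv ℝ m) (φ 1, φ 1) :=
    ((hm2.restrict_scalars ℝ).fderiv_right (m := 1) (by norm_num)).differentiableAt (by simp)
  have hev : (fun p => fderiv ℝ m p (0, w)) =ᶠ[nhds (φ 1, φ 1)] fun p => fderiv ℂ m p (0, w) := by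
    filter_upwards [hdiff] with p hp
    rw [hp.fderiv_restrictScalars ℝ]
    rfl
  have h1 := (hDR.hasFDerivAt.clm_apply (hasFDerivAt_const ((0 : E), w) (φ 1, φ 1))).congr_of_eventuallyEq
    hev.symm
  have h2 := (hDC.hasFDerivAt.clm_apply (hasFDerivAt_const ((0 : E), w) (φ 1, φ 1))).restrictScalars ℝ
  have := congrArg (fun L : E × E →L[ℝ] E => L (v, 0)) (h1.unique h2)
  simpa [mixedDeriv, ← hφ, ← hm] using this

variable [T2Space G] [CompleteSpace E]

/-- The curve is `x + iy ↦ γ x * η y`, where `γ` and `η` are the real one-parameter subgroups of `v`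
and `iv`. They commute by bilinearity of the mixed derivative, which makes the product a
homomorphism. -/
theorem exists_isOneParameterSubgroup_complex (v : E) :
    ∃ γ : ℂ → G, IsOneParameterSubgroup v γ := by
  have : LieGroup 𝓘(ℝ, E) ω G := lieGroup_restrictScalars
  have : LieGroup 𝓘(ℝ, E) ∞ G := LieGroup.of_le (n := ω) le_top
  have : LieGroup 𝓘(ℝ, E) 1 G := LieGroup.of_le (n := ω) le_top
  obtain ⟨γ, hγ⟩ := exists_isOneParameterSubgroup (G := G) v
  obtain ⟨η, hη⟩ := exists_isOneParameterSubgroup (G := G) (Complex.I • v)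
  have hc : ∀ s t, Commute (γ s) (η t) := by
    refine commute_of_mixedDeriv_eq hγ hη ?_
    have e1 : ((0 : E), Complex.I • v) = Complex.I • (0, v) := by simp
    have e2 : (Complex.I • v, (0 : E)) = Complex.I • (v, 0) := by simp
    rw [mixedDeriv_eq_complex, mixedDeriv_eq_complex, e1, e2, map_smul, map_smul]
    rfl
  have hγc : ContinuousAt (fun z : ℂ => γ z.re) 0 :=
    ContinuousAt.comp (f := Complex.re) (g := γ) (by simpa using hγ.continuousAt)
      Complex.continuous_re.continuousAt
  have hηc : ContinuousAt (fun z : ℂ => η z.im) 0 :=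
    ContinuousAt.comp (f := Complex.im) (g := η) (by simpa using hη.continuousAt)
      Complex.continuous_im.continuousAt
  refine ⟨fun z => γ z.re * η z.im, fun s t => ?_, ?_, ?_⟩
  · rw [Complex.add_re, Complex.add_im, hγ.map_add, hη.map_add, mul_assoc, mul_assoc,
      ← mul_assoc (γ t.re), (hc t.re s.im).eq, mul_assoc]
  · exact ((contMDiff_mul 𝓘(ℝ, E) 1 (G := G)).continuous.tendsto _).comp (hγc.prodMk_nhds hηc)
  · have h1 : HasFDerivAt (fun z : ℂ => chartAt E (1 : G) (γ z.re)) _ 0 :=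
      HasFDerivAt.comp (f := Complex.re) (g := fun t => chartAt E (1 : G) (γ t)) 0
        (by simpa using hγ.hasDerivAt.hasFDerivAt) Complex.reCLM.hasFDerivAt
    have h2 : HasFDerivAt (fun z : ℂ => chartAt E (1 : G) (η z.im)) _ 0 :=
      HasFDerivAt.comp (f := Complex.im) (g := fun t => chartAt E (1 : G) (η t)) 0
        (by simpa using hη.hasDerivAt.hasFDerivAt) Complex.imCLM.hasFDerivAt
    have h3 := hasFDerivAt_chartAt_mul (f := fun z : ℂ => γ z.re) (g := fun z : ℂ => η z.im)
      (x₀ := 0) (by simp [hγ.map_zero]) (by simp [hη.map_zero]) hγc hηc h1 h2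
    rw [hasDerivAt_iff_hasFDerivAt]
    -- The real derivative at `0` is `z ↦ z • v`; being complex linear, it is a complex derivative.
    refine hasFDerivAt_of_restrictScalars ℝ h3 ?_
    ext z
    change z • v = z.re • v + z.im • Complex.I • v
    conv_lhs => rw [← Complex.re_add_im z]
    rw [add_smul, mul_smul, Complex.coe_smul, Complex.coe_smul]

theorem IsOneParameterSubgroup.unique_complex {v : E} {γ η : ℂ → G}
    (hγ : IsOneParameterSubgroup v γ) (hη : IsOneParameterSubgroup v η) : γ = η := by
  have : LieGroup 𝓘(ℝ, E) ω G := lieGroup_restrictScalars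
  have : LieGroup 𝓘(ℝ, E) ∞ G := LieGroup.of_le (n := ω) le_top
  funext z
  simpa using congrFun ((hγ.comp_mul z).comp_ofReal.unique (hη.comp_mul z).comp_ofReal) 1

/-- Along the real line `t ↦ u + t z` the curve is an integral curve of the left-invariant field of
`z • v`. Compare the lines with `u = s` and `u = 0`, the latter translated by `γ s`, at `t = 1`. -/
theorem IsOneParameterCurve.map_add_complex {v : E} {γ : ℂ → G}
    (h : IsOneParameterCurve (𝕜 := ℂ) (E := E) v γ) (s z : ℂ) : γ (s + z) = γ s * γ z := by
  have : LieGroup 𝓘(ℝ, E) ω G := lieGroup_restrictScalars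
  have : LieGroup 𝓘(ℝ, E) ∞ G := LieGroup.of_le (n := ω) le_top
  have : LieGroup 𝓘(ℝ, E) 1 G := LieGroup.of_le (n := ω) le_top
  have key : ∀ u : ℂ, IsMIntegralCurve (I := 𝓘(ℝ, E)) (fun t : ℝ => γ (u + t * z))
      (mulInvariantVectorField (z • v : E)) := by
    intro u t
    have h1 : HasMFDerivAt 𝓘(ℝ, ℝ) 𝓘(ℝ, ℂ) (fun t : ℝ => u + t * z) t
        ((1 : ℝ →L[ℝ] ℝ).smulRight z) := by
      refine hasMFDerivAt_iff_hasFDerivAt.2 ?_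
      have : HasDerivAt (fun t : ℝ => u + t * z) z t := by
        simpa using ((hasDerivAt_id t).ofReal_comp.mul_const z).const_add u
      refine this.hasFDerivAt.congr_fderiv ?_
      ext
      simp only [ContinuousLinearMap.toSpanSingleton_apply]
      rfl
    have h2 := hasMFDerivAt_restrictScalars (h.2 (u + t * z))
    refine hasMFDerivAt_congr (HasMFDerivAt.comp (g := γ) t h2 h1) rfl ?_
    ext
    have e := mulInvariantVectorField_restrictScalars (z • v) (γ (u + t * z))
    have e2 := congrFun (mulInvariantVectorField_smul (I := 𝓘(ℂ, E)) (G := G) z v) (γ (u + t * z))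
    change ((1 : ℝ) • z) • (mulInvariantVectorField (I := 𝓘(ℂ, E)) (G := G) v (γ (u + t * z)) : E) =
      (1 : ℝ) • (mulInvariantVectorField (I := 𝓘(ℝ, E)) (G := G) (z • v : E) (γ (u + t * z)) : E)
    refine Eq.trans ?_ (one_smul ℝ _).symm
    refine Eq.trans ?_ e.symm
    refine Eq.trans ?_ e2.symm
    rw [one_smul]
    rfl
  have h1 : IsMIntegralCurve (I := 𝓘(ℝ, E)) (fun t : ℝ => γ s * γ (0 + t * z))
      (mulInvariantVectorField (z • v : E)) :=
    fun t => hasMFDerivAt_mul_left_integralCurve _ (key 0 t)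
  simpa using congrFun (integralCurve_unique (key s) h1 (by simp [h.1])) 1

theorem IsOneParameterSubgroup.lieExp_eq_complex {v : E} {γ : ℂ → G}
    (h : IsOneParameterSubgroup v γ) : lieExp (𝕜 := ℂ) (E := E) v = γ 1 := by
  have : LieGroup 𝓘(ℂ, E) 1 G := LieGroup.of_le (n := ω) le_top
  have hex : ∃ γ : ℂ → G, IsOneParameterCurve (𝕜 := ℂ) (E := E) v γ := ⟨γ, h.isOneParameterCurve⟩
  have h1 := hex.choose_spec
  refine (dif_pos hex).trans ?_
  rw [(h1.isOneParameterSubgroup h1.map_add_complex).unique_complex h]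

theorem isOneParameterSubgroup_lieExp_complex (v : E) :
    IsOneParameterSubgroup v (fun z : ℂ => (lieExp (𝕜 := ℂ) (E := E) (z • v) : G)) := by
  obtain ⟨γ, hγ⟩ := exists_isOneParameterSubgroup_complex (G := G) v
  convert hγ using 1
  funext t
  refine ((hγ.comp_mul t).lieExp_eq_complex).trans ?_
  simp

/-- An element commuting with the real points of a complex one-parameter subgroup commutes with all
of it. -/
theorem IsOneParameterSubgroup.commute_of_commute_real {v : E} {γ : ℂ → G}
    (h : IsOneParameterSubgroup v γ) {c : G} (hc : ∀ t : ℝ, Commute c (γ t)) (z : ℂ) :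
    Commute c (γ z) := by
  have : LieGroup 𝓘(ℂ, E) 1 G := LieGroup.of_le (n := ω) le_top
  have h1 := h.conj c
  have h2 : (fun t : ℝ => c * γ t * c⁻¹) = fun t : ℝ => γ t := by
    funext t
    exact mul_inv_eq_iff_eq_mul.2 (hc t)
  have h3 := h1.comp_ofReal
  rw [h2] at h3
  rw [h3.velocity_unique h.comp_ofReal] at h1
  exact mul_inv_eq_iff_eq_mul.1 (congrFun (h1.unique_complex h) z)

theorem commute_lieExp_complex {v w : E}
    (h : ∀ s t : ℝ, Commute (lieExp (𝕜 := ℂ) (E := E) ((s : ℂ) • v) : G)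
      (lieExp (𝕜 := ℂ) (E := E) ((t : ℂ) • w))) (s t : ℂ) :
    Commute (lieExp (𝕜 := ℂ) (E := E) (s • v) : G) (lieExp (𝕜 := ℂ) (E := E) (t • w)) := by
  have hv := isOneParameterSubgroup_lieExp_complex (G := G) v
  have hw := isOneParameterSubgroup_lieExp_complex (G := G) w
  exact hw.commute_of_commute_real
    (fun t => (hv.commute_of_commute_real (fun s => (h s t).symm) s).symm) t

theorem lieExp_add_complex {v w : E}
    (h : ∀ s t : ℂ, Commute (lieExp (𝕜 := ℂ) (E := E) (s • v) : G)
      (lieExp (𝕜 := ℂ) (E := E) (t • w))) :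
    (lieExp (𝕜 := ℂ) (E := E) (v + w : E) : G) =
      lieExp (𝕜 := ℂ) (E := E) v * lieExp (𝕜 := ℂ) (E := E) w := by
  have : LieGroup 𝓘(ℂ, E) 1 G := LieGroup.of_le (n := ω) le_top
  have h1 := ((isOneParameterSubgroup_lieExp_complex (G := G) v).mul
    (isOneParameterSubgroup_lieExp_complex (G := G) w) h).lieExp_eq_complex
  simpa using h1

end Complex

/-! ### Restricted roots and the polyhedron `Ω`. -/

section Roots

variable {𝔤 : Type*} [LieRing 𝔤] [LieAlgebra ℝ 𝔤]

/-- The inner product `(X, Y) ↦ -κ(X, θ Y) - κ(Y, θ X)` of a Cartan involution `θ`. -/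
abbrev IsCartanInvolution.innerCore {θ : 𝔤 →ₗ⁅ℝ⁆ 𝔤} (hθ : IsCartanInvolution θ) :
    InnerProductSpace.Core ℝ 𝔤 where
  inner X Y := -(killingForm ℝ 𝔤 X (θ Y)) - killingForm ℝ 𝔤 Y (θ X)
  conj_inner_symm X Y := by simp; ring
  re_inner_nonneg X := by
    rcases eq_or_ne X 0 with rfl | hX
    · simp
    · have := hθ.posDef X hX
      simp only [RCLike.re_to_real]
      linarith
  add_left X Y Z := by simp; ring
  smul_left X Y r := by simp; ring
  definite X h := by
    by_contra hX
    have := hθ.posDef X hX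
    linarith

/-- Invariance of the Killing form gives one sign and `θ H = -H` cancels it. Hence `ad H` is
symmetric for the inner product of `θ`. -/
theorem killingForm_lie_map_of_map_eq_neg {θ : 𝔤 →ₗ⁅ℝ⁆ 𝔤} {H : 𝔤} (hH : θ H = -H) (X Y : 𝔤) :
    killingForm ℝ 𝔤 ⁅H, X⁆ (θ Y) = killingForm ℝ 𝔤 X (θ ⁅H, Y⁆) := by
  rw [← lie_skew, map_neg, LinearMap.neg_apply, LieModule.traceForm_apply_lie_apply,
    LieHom.map_lie, hH, neg_lie, map_neg]

/-- The operators `ad H`, `H ∈ 𝔞`, are symmetric and commute, so their joint eigenspaces span `𝔤`.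
Each joint eigenvalue is zero or a restricted root, so `ad H₀ = 0`; then `κ(H₀, θ H₀) = 0`, and
positivity forces `H₀ = 0`. -/
theorem eq_zero_of_restrictedRoots_apply_eq_zero [FiniteDimensional ℝ 𝔤] {θ : 𝔤 →ₗ⁅ℝ⁆ 𝔤}
    (hθ : IsCartanInvolution θ) {𝔞 : Submodule ℝ 𝔤} (h𝔞 : IsAbelianSubspaceOfP θ 𝔞) {H₀ : 𝔞}
    (h : ∀ α ∈ restrictedRoots 𝔞, α H₀ = 0) : H₀ = 0 := by
  let := hθ.innerCore
  let : NormedAddCommGroup 𝔤 := hθ.innerCore.toNormedAddCommGroup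
  let : InnerProductSpace ℝ 𝔤 := InnerProductSpace.ofCore hθ.innerCore.toCore
  let T : 𝔞 → 𝔤 →ₗ[ℝ] 𝔤 := fun H => LieModule.toEnd ℝ 𝔤 𝔤 (H : 𝔤)
  have hT : ∀ H, (T H).IsSymmetric := by
    intro H X Y
    have hH := h𝔞.1 H H.2
    change -(killingForm ℝ 𝔤 ⁅(H : 𝔤), X⁆ (θ Y)) - killingForm ℝ 𝔤 Y (θ ⁅(H : 𝔤), X⁆) =
      -(killingForm ℝ 𝔤 X (θ ⁅(H : 𝔤), Y⁆)) - killingForm ℝ 𝔤 ⁅(H : 𝔤), Y⁆ (θ X)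
    rw [killingForm_lie_map_of_map_eq_neg hH, killingForm_lie_map_of_map_eq_neg hH]
  have hc : Pairwise (Function.onFun Commute T) := by
    intro H H' _
    refine LinearMap.ext fun X => ?_
    change ⁅(H : 𝔤), ⁅(H' : 𝔤), X⁆⁆ = ⁅(H' : 𝔤), ⁅(H : 𝔤), X⁆⁆
    rw [leibniz_lie, h𝔞.2 H H.2 H' H'.2, zero_lie, zero_add]
  have htop := LinearMap.IsSymmetric.iSup_iInf_eq_top_of_commute hT hc
  have hker : (⨆ χ : 𝔞 → ℝ, ⨅ H, Module.End.eigenspace (T H) (χ H)) ≤ LinearMap.ker (T H₀) := by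
    refine iSup_le fun χ X hX => ?_
    rw [Submodule.mem_iInf] at hX
    have hX' : ∀ H : 𝔞, ⁅(H : 𝔤), X⁆ = χ H • X := fun H =>
      Module.End.mem_eigenspace_iff.1 (hX H)
    rw [LinearMap.mem_ker]
    change ⁅(H₀ : 𝔤), X⁆ = 0
    by_cases hX0 : X = 0
    · simp [hX0]
    -- The eigenvalue `χ` is a priori just a function on `𝔞`; a nonzero joint eigenvector makes it
    -- linear.
    let α : Module.Dual ℝ 𝔞 :=
      { toFun := χ
        map_add' := fun H H' => by
          apply smul_left_injective ℝ hX0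
          simp only [add_smul, ← hX', Submodule.coe_add, add_lie]
        map_smul' := fun r H => by
          apply smul_left_injective ℝ hX0
          simp only [← hX', Submodule.coe_smul, smul_lie, RingHom.id_apply, smul_eq_mul, mul_smul] }
    have hα : α H₀ = 0 := by
      by_cases hα0 : α = 0
      · simp [hα0]
      · exact h α ⟨hα0, X, hX0, hX'⟩
    rw [hX' H₀]
    change α H₀ • X = 0
    rw [hα, zero_smul]
  rw [htop, top_le_iff, LinearMap.ker_eq_top] at hker
  by_contra hne
  have hpos := hθ.posDef (H₀ : 𝔤) (by simpa using hne)
  have : killingForm ℝ 𝔤 (H₀ : 𝔤) (θ H₀) = 0 := by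
    have e : LieModule.toEnd ℝ 𝔤 𝔤 (H₀ : 𝔤) = 0 := hker
    rw [killingForm, LieModule.traceForm_apply_apply, e, LinearMap.zero_comp, map_zero]
  linarith

theorem zero_mem_omega (𝔞 : Submodule ℝ 𝔤) : (0 : 𝔞) ∈ omega 𝔞 := fun α _ => by
  simpa using Real.pi_pos

theorem convex_omega (𝔞 : Submodule ℝ 𝔤) : Convex ℝ (omega 𝔞) := by
  intro X hX Y hY a b ha hb hab α hα
  rw [map_add, map_smul, map_smul]
  have h := convex_ball (0 : ℝ) (Real.pi / 2) (x := α X) (by simpa using hX α hα) (y := α Y)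
    (by simpa using hY α hα) ha hb hab
  simpa using h

variable [TopologicalSpace 𝔤] [IsTopologicalAddGroup 𝔤] [ContinuousSMul ℝ 𝔤] [T2Space 𝔤]
  [FiniteDimensional ℝ 𝔤]

theorem abs_le_of_mem_closure_omega {𝔞 : Submodule ℝ 𝔤} {X : 𝔞} (hX : X ∈ closure (omega 𝔞))
    {α : Module.Dual ℝ 𝔞} (hα : α ∈ restrictedRoots 𝔞) : |α X| ≤ Real.pi / 2 := by
  have hc : Continuous α := LinearMap.continuous_of_finiteDimensional α
  have : IsClosed {X : 𝔞 | |α X| ≤ Real.pi / 2} := isClosed_le (by fun_prop) (by fun_prop)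
  exact closure_minimal (fun Y hY => (hY α hα).le) this hX

/-- Shrinking makes the root inequalities strict; this is how boundary points are moved to where `f`
is holomorphic. -/
theorem smul_mem_omega {𝔞 : Submodule ℝ 𝔤} {X : 𝔞} (hX : X ∈ closure (omega 𝔞)) {r : ℝ}
    (h0 : 0 ≤ r) (h1 : r < 1) : r • X ∈ omega 𝔞 := by
  intro α hα
  rw [map_smul, smul_eq_mul, abs_mul, abs_of_nonneg h0]
  have := abs_le_of_mem_closure_omega hX hα
  have hpi := Real.pi_pos
  nlinarith [abs_nonneg (α X)]

/-- The roots separate points, so together they embed `𝔞` as a closed subspace of a power of `ℝ`,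
and the closure of `Ω` lands in a cube. The cube is compact by Tychonoff, without counting the
roots. -/
theorem isCompact_closure_omega {θ : 𝔤 →ₗ⁅ℝ⁆ 𝔤} (hθ : IsCartanInvolution θ) {𝔞 : Submodule ℝ 𝔤}
    (h𝔞 : IsAbelianSubspaceOfP θ 𝔞) : IsCompact (closure (omega 𝔞)) := by
  let L : 𝔞 →ₗ[ℝ] (restrictedRoots 𝔞 → ℝ) := LinearMap.pi fun α => (α : Module.Dual ℝ 𝔞)
  have hL : Function.Injective L := by
    rw [← LinearMap.ker_eq_bot, LinearMap.ker_eq_bot']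
    intro X hX
    exact eq_zero_of_restrictedRoots_apply_eq_zero hθ h𝔞 fun α hα => congrFun hX ⟨α, hα⟩
  have hemb := LinearMap.isClosedEmbedding_of_injective (LinearMap.ker_eq_bot.2 hL)
  have hcomp : IsCompact (L ⁻¹' Set.pi Set.univ fun _ => Set.Icc (-(Real.pi / 2)) (Real.pi / 2)) :=
    hemb.isCompact_preimage (isCompact_univ_pi fun _ => isCompact_Icc)
  refine hcomp.of_isClosed_subset isClosed_closure fun X hX => ?_
  exact fun α _ => abs_le.1 (abs_le_of_mem_closure_omega hX α.2)

theorem extremeOmega_nonempty [LocallyConvexSpace ℝ 𝔤] {θ : 𝔤 →ₗ⁅ℝ⁆ 𝔤}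
    (hθ : IsCartanInvolution θ) {𝔞 : Submodule ℝ 𝔤} (h𝔞 : IsAbelianSubspaceOfP θ 𝔞) :
    (extremeOmega 𝔞).Nonempty :=
  (isCompact_closure_omega hθ h𝔞).extremePoints_nonempty ⟨0, subset_closure (zero_mem_omega 𝔞)⟩

/-- A closed convex subset of `𝔞` containing `∂ₑΩ` contains `Ω`. -/
theorem omega_subset_of_extremeOmega_subset [LocallyConvexSpace ℝ 𝔤] {θ : 𝔤 →ₗ⁅ℝ⁆ 𝔤}
    (hθ : IsCartanInvolution θ) {𝔞 : Submodule ℝ 𝔤} (h𝔞 : IsAbelianSubspaceOfP θ 𝔞) {D : Set 𝔞}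
    (hconv : Convex ℝ D) (hclosed : IsClosed D) (hD : extremeOmega 𝔞 ⊆ D) :
    closure (omega 𝔞) ⊆ D := by
  -- Krein–Milman.
  rw [← closure_convexHull_extremePoints (isCompact_closure_omega hθ h𝔞) (convex_omega 𝔞).closure]
  exact closure_minimal (convexHull_min hD hconv) hclosed

end Roots

/-! ### Exponentials `exp(z dι X)` in the complexification. -/

section ExpI

variable {E : Type*} [NormedAddCommGroup E] [NormedSpace ℝ E] [CompleteSpace E]
  {G : Type u} [TopologicalSpace G] [T2Space G] [ChartedSpace E G] [Group G]
  [LieGroup 𝓘(ℝ, E) ∞ G]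
  {E' : Type*} [NormedAddCommGroup E'] [NormedSpace ℂ E'] [CompleteSpace E']
  {GC : Type u} [TopologicalSpace GC] [T2Space GC] [ChartedSpace E' GC] [Group GC]
  [LieGroup 𝓘(ℂ, E') ω GC] {ι : G →* GC}

omit [CompleteSpace E] [T2Space G] [LieGroup 𝓘(ℝ, E) ∞ G] [CompleteSpace E'] [T2Space GC]
  [LieGroup 𝓘(ℂ, E') ω GC] in
theorem hasMFDerivAt_lieDifferential (hι : ContMDiff 𝓘(ℝ, E) 𝓘(ℝ, E') ∞ ι) :
    ∃ L : E →L[ℝ] E', HasMFDerivAt 𝓘(ℝ, E) 𝓘(ℝ, E') ι 1 L ∧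
      ∀ X : GroupLieAlgebra 𝓘(ℝ, E) G, lieDifferential E' ι X = L X :=
  ⟨mfderiv 𝓘(ℝ, E) 𝓘(ℝ, E') ι 1, ((hι.mdifferentiable (by simp)) 1).hasMFDerivAt, fun _ => rfl⟩

omit [CompleteSpace E] [T2Space G] [LieGroup 𝓘(ℝ, E) ∞ G] [CompleteSpace E'] [T2Space GC]
  [LieGroup 𝓘(ℂ, E') ω GC] in
theorem lieDifferential_smul (hι : ContMDiff 𝓘(ℝ, E) 𝓘(ℝ, E') ∞ ι) (r : ℝ)
    (X : GroupLieAlgebra 𝓘(ℝ, E) G) :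
    (lieDifferential E' ι (r • X) : E') = (r : ℂ) • (lieDifferential E' ι X : E') := by
  obtain ⟨L, -, hL⟩ := hasMFDerivAt_lieDifferential hι
  refine (hL _).trans ((L.map_smul r X).trans ?_)
  rw [Complex.coe_smul]
  exact congrArg (fun v : E' => r • v) (hL X).symm

/-- The complex one-parameter subgroup `z ↦ exp(z dι X)` of `GC`. -/
def complexExp (E' : Type*) [NormedAddCommGroup E'] [NormedSpace ℂ E'] [ChartedSpace E' GC]
    (ι : G →* GC) (X : GroupLieAlgebra 𝓘(ℝ, E) G) (z : ℂ) : GC :=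
  lieExp (𝕜 := ℂ) (E := E') (z • (lieDifferential E' ι X : E'))

omit [CompleteSpace E] [T2Space G] [LieGroup 𝓘(ℝ, E) ∞ G] [CompleteSpace E'] [T2Space GC]
  [LieGroup 𝓘(ℂ, E') ω GC] in
theorem expI_eq_complexExp (X : GroupLieAlgebra 𝓘(ℝ, E) G) :
    expI E' ι X = complexExp E' ι X Complex.I := rfl

omit [CompleteSpace E] [T2Space G] [LieGroup 𝓘(ℝ, E) ∞ G] in
theorem isOneParameterSubgroup_complexExp (X : GroupLieAlgebra 𝓘(ℝ, E) G) :
    IsOneParameterSubgroup (E := E') (lieDifferential E' ι X) (complexExp E' ι X) :=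
  isOneParameterSubgroup_lieExp_complex _

theorem complexExp_smul (hι : ContMDiff 𝓘(ℝ, E) 𝓘(ℝ, E') ∞ ι) (r : ℝ)
    (X : GroupLieAlgebra 𝓘(ℝ, E) G) (z : ℂ) :
    complexExp E' ι (r • X) z = complexExp E' ι X (z * r) := by
  simp only [complexExp]
  rw [lieDifferential_smul hι, mul_smul]

omit [CompleteSpace E] [T2Space G] [LieGroup 𝓘(ℝ, E) ∞ G] in
theorem mdifferentiable_complexExp (X : GroupLieAlgebra 𝓘(ℝ, E) G) :
    MDifferentiable 𝓘(ℂ, ℂ) 𝓘(ℂ, E') (complexExp E' ι X) := by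
  have : LieGroup 𝓘(ℂ, E') 1 GC := LieGroup.of_le (n := ω) le_top
  exact fun z => ((isOneParameterSubgroup_complexExp (E' := E') (ι := ι)
    X).isOneParameterCurve.2 z).mdifferentiableAt

/-- `exp(t dι X) = ι(exp(tX))` for real `t`. -/
theorem complexExp_ofReal (hι : ContMDiff 𝓘(ℝ, E) 𝓘(ℝ, E') ∞ ι)
    (X : GroupLieAlgebra 𝓘(ℝ, E) G) (t : ℝ) :
    complexExp E' ι X t = ι (lieExp (t • X)) := by
  have : LieGroup 𝓘(ℝ, E') ω GC := lieGroup_restrictScalars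
  have : LieGroup 𝓘(ℝ, E') ∞ GC := LieGroup.of_le (n := ω) le_top
  obtain ⟨L, h1, hL⟩ := hasMFDerivAt_lieDifferential hι
  have h2 := (isOneParameterSubgroup_lieExp_real X).map h1
  have h3 := (isOneParameterSubgroup_complexExp (E' := E') (ι := ι) X).comp_ofReal
  rw [hL X] at h3
  exact congrFun (h3.unique h2) t

/-- For real parameters these are images under `ι` of commuting elements of `G`; commutation extends
to complex parameters one variable at a time. -/
theorem commute_complexExp (hι : ContMDiff 𝓘(ℝ, E) 𝓘(ℝ, E') ∞ ι)
    {X Y : GroupLieAlgebra 𝓘(ℝ, E) G} (h : ⁅X, Y⁆ = 0) (z w : ℂ) :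
    Commute (complexExp E' ι X z) (complexExp E' ι Y w) := by
  refine commute_lieExp_complex (fun s t => ?_) z w
  have h1 := (commute_lieExp_of_bracket_eq_zero h s t).map ι
  rw [← complexExp_ofReal hι, ← complexExp_ofReal hι] at h1
  exact h1

theorem expI_add (hι : ContMDiff 𝓘(ℝ, E) 𝓘(ℝ, E') ∞ ι)
    {X Y : GroupLieAlgebra 𝓘(ℝ, E) G} (h : ⁅X, Y⁆ = 0) :
    expI E' ι (X + Y) = expI E' ι X * expI E' ι Y := by
  obtain ⟨L, -, hL⟩ := hasMFDerivAt_lieDifferential hι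
  have hexp : ∀ (X : GroupLieAlgebra 𝓘(ℝ, E) G) (z : ℂ),
      complexExp E' ι X z = lieExp (𝕜 := ℂ) (E := E') (z • L X) := fun X z =>
    congrArg (fun v : E' => lieExp (𝕜 := ℂ) (E := E') (z • v)) (hL X)
  rw [expI_eq_complexExp, expI_eq_complexExp, expI_eq_complexExp, hexp, hexp, hexp]
  refine Eq.trans ?_ (lieExp_add_complex (E := E') (G := GC) (v := Complex.I • L X)
    (w := Complex.I • L Y) fun s t => ?_)
  · exact congrArg (fun v : E' => lieExp (𝕜 := ℂ) (E := E') v)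
      ((congrArg (fun v : E' => Complex.I • v) (L.map_add X Y)).trans (smul_add _ _ _))
  · rw [smul_smul, smul_smul, ← hexp, ← hexp]
    exact commute_complexExp hι h _ _

theorem continuous_expI_smul (hι : ContMDiff 𝓘(ℝ, E) 𝓘(ℝ, E') ∞ ι)
    (X : GroupLieAlgebra 𝓘(ℝ, E) G) : Continuous fun r : ℝ => expI E' ι (r • X) := by
  simp only [expI_eq_complexExp, complexExp_smul hι]
  exact (mdifferentiable_complexExp X).continuous.comp (by fun_prop)

/-- The points of the complexified orbit of a one-parameter subgroup of `𝔞`. -/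
theorem map_mul_complexExp_mul_expI (hι : ContMDiff 𝓘(ℝ, E) 𝓘(ℝ, E') ∞ ι)
    {X W : GroupLieAlgebra 𝓘(ℝ, E) G} (h : ⁅X, W⁆ = 0) (g : G) (z : ℂ) :
    ι g * complexExp E' ι W (Complex.I * z) * expI E' ι X =
      ι (g * lieExp ((-z.im) • W)) * expI E' ι (X + z.re • W) := by
  -- The real part of `iz` contributes a factor from `G`, the imaginary part a shift of `X`.
  have e1 : Complex.I * z = ((-z.im : ℝ) : ℂ) + Complex.I * z.re := by
    apply Complex.ext <;> simp
  have e2 : ⁅X, z.re • W⁆ = 0 := by rw [lie_smul, h, smul_zero]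
  rw [e1, (isOneParameterSubgroup_complexExp (E' := E') (ι := ι) W).map_add, complexExp_ofReal hι,
    ← complexExp_smul hι, ← expI_eq_complexExp, expI_add hι e2, map_mul]
  have e3 : Commute (expI E' ι X) (expI E' ι (z.re • W)) := commute_complexExp hι e2 _ _
  rw [e3.eq]
  simp only [mul_assoc]

/-- On the abelian `𝔞`, `expI` is the product of its values along the coordinates of a basis, and
each factor is a continuous one-parameter curve. -/
theorem continuous_expI [FiniteDimensional ℝ E] (hι : ContMDiff 𝓘(ℝ, E) 𝓘(ℝ, E') ∞ ι)
    {𝔞 : Submodule ℝ (GroupLieAlgebra 𝓘(ℝ, E) G)}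
    (h𝔞 : ∀ X ∈ 𝔞, ∀ Y ∈ 𝔞, ⁅X, Y⁆ = 0) :
    Continuous fun X : 𝔞 => expI E' ι (X : GroupLieAlgebra 𝓘(ℝ, E) G) := by
  have : IsTopologicalGroup GC := topologicalGroup_of_lieGroup 𝓘(ℂ, E') ω
  have : FiniteDimensional ℝ (GroupLieAlgebra 𝓘(ℝ, E) G) := inferInstanceAs (FiniteDimensional ℝ E)
  have : T2Space (GroupLieAlgebra 𝓘(ℝ, E) G) := inferInstanceAs (T2Space E)
  let b := Module.finBasis ℝ 𝔞
  have key : ∀ s : Finset (Fin (Module.finrank ℝ 𝔞)), Continuous fun X : 𝔞 =>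
      expI E' ι ((∑ j ∈ s, b.repr X j • b j : 𝔞) : GroupLieAlgebra 𝓘(ℝ, E) G) := by
    intro s
    induction s using Finset.induction_on with
    | empty => simpa using continuous_const
    | insert a s ha ih =>
      have : ∀ X : 𝔞, expI E' ι ((∑ j ∈ insert a s, b.repr X j • b j : 𝔞) :
          GroupLieAlgebra 𝓘(ℝ, E) G) =
          expI E' ι (b.repr X a • ((b a : 𝔞) : GroupLieAlgebra 𝓘(ℝ, E) G)) *
            expI E' ι ((∑ j ∈ s, b.repr X j • b j : 𝔞) : GroupLieAlgebra 𝓘(ℝ, E) G) := by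
        intro X
        rw [Finset.sum_insert ha, Submodule.coe_add, Submodule.coe_smul]
        exact expI_add hι (h𝔞 _ (𝔞.smul_mem _ (b a).2) _ (Subtype.prop _))
      simp only [this]
      refine Continuous.mul ((continuous_expI_smul hι _).comp ?_) ih
      exact LinearMap.continuous_of_finiteDimensional (b.coord a)
  simpa [b.sum_repr] using key Finset.univ

end ExpI

/-! ### The maximum principle on a strip. -/

/-- The maximum principle on a strip for a bounded function which is a limit of functions
holomorphic on the strip. -/
theorem norm_le_on_strip_of_limit {F : ℝ → ℂ → ℂ} {M C : ℝ}
    (hcont : ContinuousOn (Function.uncurry F)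
      (Set.Icc 0 1 ×ˢ (Complex.re ⁻¹' Set.Icc 0 1)))
    (hdiff : ∀ r ∈ Set.Ico (0 : ℝ) 1, DifferentiableOn ℂ (F r) (Complex.re ⁻¹' Set.Ioo 0 1))
    (hM : ∀ z : ℂ, z.re ∈ Set.Icc (0 : ℝ) 1 → ‖F 1 z‖ ≤ M)
    (h0 : ∀ z : ℂ, z.re = 0 → ‖F 1 z‖ ≤ C) (h1 : ∀ z : ℂ, z.re = 1 → ‖F 1 z‖ ≤ C)
    {z : ℂ} (hz : z.re ∈ Set.Icc (0 : ℝ) 1) : ‖F 1 z‖ ≤ C := by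
  have hopen : IsOpen (Complex.re ⁻¹' Set.Ioo 0 1) := isOpen_Ioo.preimage Complex.continuous_re
  have hclosed : IsClosed (Complex.re ⁻¹' Set.Icc 0 1) :=
    isClosed_Icc.preimage Complex.continuous_re
  have hsub : Complex.re ⁻¹' Set.Ioo 0 1 ⊆ Complex.re ⁻¹' Set.Icc 0 1 :=
    Set.preimage_mono Set.Ioo_subset_Icc_self
  -- Joint continuity is uniform on compact sets, so `F r → F 1` locally uniformly and the limit is
  -- holomorphic.
  have hlim : TendstoLocallyUniformlyOn F (F 1) (nhdsWithin 1 (Set.Ico (0 : ℝ) 1))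
      (Complex.re ⁻¹' Set.Ioo 0 1) := by
    rw [tendstoLocallyUniformlyOn_iff_forall_isCompact hopen]
    intro K hKs hK
    have hu : UniformContinuousOn (Function.uncurry F) (Set.Icc 0 1 ×ˢ K) :=
      (isCompact_Icc.prod hK).uniformContinuousOn_of_continuous
        (hcont.mono (Set.prod_mono le_rfl (hKs.trans hsub)))
    intro u hu'
    exact (hu.tendstoUniformlyOn (by simp) u hu').filter_mono
      (nhdsWithin_mono 1 Set.Ico_subset_Icc_self)
  have hne : (nhdsWithin (1 : ℝ) (Set.Ico 0 1)).NeBot := by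
    rw [← mem_closure_iff_nhdsWithin_neBot, closure_Ico zero_ne_one]
    simp
  have hd : DifferentiableOn ℂ (F 1) (Complex.re ⁻¹' Set.Ioo 0 1) :=
    hlim.differentiableOn (Filter.eventually_of_mem self_mem_nhdsWithin hdiff) hopen
  have hc : ContinuousOn (F 1) (Complex.re ⁻¹' Set.Icc 0 1) :=
    hcont.comp (f := fun z : ℂ => ((1 : ℝ), z)) (by fun_prop) fun z hz => ⟨by simp, hz⟩
  -- The two zeros are the constants of the Phragmén–Lindelöf growth bound, which then reads `O(1)`
  -- and follows from `hM`.
  refine PhragmenLindelof.vertical_strip (a := 0) (b := 1)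
    ⟨hd, hc.mono (closure_minimal hsub hclosed)⟩ ⟨0, by simpa using Real.pi_pos, 0, ?_⟩ h0 h1
    hz.1 hz.2
  refine Asymptotics.IsBigO.of_bound M ?_
  filter_upwards [Filter.mem_inf_of_right (Filter.mem_principal_self _)] with z hz
  simpa using hM z (hsub hz)

/-! ### The maximum principle on the crown. -/

section CrownDomain

variable {E : Type*} [NormedAddCommGroup E] [NormedSpace ℝ E] [CompleteSpace E]
  [FiniteDimensional ℝ E]
  {G : Type u} [TopologicalSpace G] [T2Space G] [ChartedSpace E G] [Group G]
  [LieGroup 𝓘(ℝ, E) ∞ G]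
  {E' : Type*} [NormedAddCommGroup E'] [NormedSpace ℂ E'] [CompleteSpace E']
  {GC : Type u} [TopologicalSpace GC] [T2Space GC] [ChartedSpace E' GC] [Group GC]
  [LieGroup 𝓘(ℂ, E') ω GC] {ι : G →* GC} {K : Subgroup G}
  {𝔞 : Submodule ℝ (GroupLieAlgebra 𝓘(ℝ, E) G)}

variable (E' ι K) in
/-- The point `g exp(iX) K_ℂ` of `G_ℂ / K_ℂ`. -/
def orbitPoint (g : G) (X : 𝔞) : ComplexQuotient E E' ι K :=
  ((ι g * expI E' ι (X : GroupLieAlgebra 𝓘(ℝ, E) G) : GC) : GC ⧸ complexifiedSubgroup E E' ι K)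

omit [FiniteDimensional ℝ E] [T2Space G] [CompleteSpace E'] [T2Space GC]
  [LieGroup 𝓘(ℂ, E') ω GC] in
theorem orbitPoint_mem_crown {X : 𝔞} (hX : X ∈ omega 𝔞) (g : G) :
    orbitPoint E' ι K g X ∈ crown E' ι K 𝔞 := ⟨g, X, hX, rfl⟩

theorem continuous_orbitPoint (hι : ContMDiff 𝓘(ℝ, E) 𝓘(ℝ, E') ∞ ι)
    (h𝔞 : ∀ X ∈ 𝔞, ∀ Y ∈ 𝔞, ⁅X, Y⁆ = 0) (g : G) :
    Continuous (orbitPoint E' ι K g : 𝔞 → ComplexQuotient E E' ι K) := by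
  have : IsTopologicalGroup GC := topologicalGroup_of_lieGroup 𝓘(ℂ, E') ω
  exact QuotientGroup.continuous_mk.comp ((continuous_expI hι h𝔞).const_mul (ι g))

theorem orbitPoint_mem_closure_crown (hι : ContMDiff 𝓘(ℝ, E) 𝓘(ℝ, E') ∞ ι)
    (h𝔞 : ∀ X ∈ 𝔞, ∀ Y ∈ 𝔞, ⁅X, Y⁆ = 0) {X : 𝔞} (hX : X ∈ closure (omega 𝔞)) (g : G) :
    orbitPoint E' ι K g X ∈ closure (crown E' ι K 𝔞) :=
  map_mem_closure (continuous_orbitPoint hι h𝔞 g) hX fun _ hY => orbitPoint_mem_crown hY g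

/-- The three lines argument: a bound for `f` on the orbits of `exp(iX)` and `exp(iY)` is a bound on
the orbits of the segment between `X` and `Y`. -/
theorem norm_le_on_segment (hι : ContMDiff 𝓘(ℝ, E) 𝓘(ℝ, E') ∞ ι)
    (h𝔞 : ∀ X ∈ 𝔞, ∀ Y ∈ 𝔞, ⁅X, Y⁆ = 0)
    {f : ComplexQuotient E E' ι K → ℂ} (hf : f ∈ crownAlgebra E' ι K 𝔞) {M C : ℝ}
    (hM : ∀ z ∈ closure (crown E' ι K 𝔞), ‖f z‖ ≤ M) {X Y : 𝔞} (hX : X ∈ closure (omega 𝔞))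
    (hY : Y ∈ closure (omega 𝔞)) (hCX : ∀ g, ‖f (orbitPoint E' ι K g X)‖ ≤ C)
    (hCY : ∀ g, ‖f (orbitPoint E' ι K g Y)‖ ≤ C) {t : ℝ} (ht : t ∈ Set.Icc (0 : ℝ) 1) (g : G) :
    ‖f (orbitPoint E' ι K g (X + t • (Y - X)))‖ ≤ C := by
  have : IsTopologicalGroup GC := topologicalGroup_of_lieGroup 𝓘(ℂ, E') ω
  have : FiniteDimensional ℝ (GroupLieAlgebra 𝓘(ℝ, E) G) := inferInstanceAs (FiniteDimensional ℝ E)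
  have : T2Space (GroupLieAlgebra 𝓘(ℝ, E) G) := inferInstanceAs (T2Space E)
  let W : 𝔞 := Y - X
  -- The factor `r` scales the whole segment towards `0`: for `r < 1` the strip maps into the crown,
  -- for `r = 1` only into its closure.
  let Q : ℝ → ℂ → GC := fun r z => ι g *
    complexExp E' ι ((r • W : 𝔞) : GroupLieAlgebra 𝓘(ℝ, E) G) (Complex.I * z) *
    expI E' ι ((r • X : 𝔞) : GroupLieAlgebra 𝓘(ℝ, E) G)
  -- `Im z` affects only the factor from `G`, so each vertical line stays in one `G`-orbit; this is
  -- why the bounds at `X` and `Y` are needed for all `g`.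
  have hQ : ∀ r z, (Q r z : GC ⧸ complexifiedSubgroup E E' ι K) =
      orbitPoint E' ι K (g * lieExp ((-z.im) • ((r • W : 𝔞) : GroupLieAlgebra 𝓘(ℝ, E) G)))
        (r • (X + z.re • W)) := by
    intro r z
    have e : ((r • (X + z.re • W) : 𝔞) : GroupLieAlgebra 𝓘(ℝ, E) G) =
        ((r • X : 𝔞) : GroupLieAlgebra 𝓘(ℝ, E) G) +
          z.re • ((r • W : 𝔞) : GroupLieAlgebra 𝓘(ℝ, E) G) := by
      rw [smul_add, smul_comm r z.re W]
      rfl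
    rw [orbitPoint, e, ← map_mul_complexExp_mul_expI hι
      (h𝔞 _ (Subtype.prop _) _ (Subtype.prop _)) g z]
  have hseg : ∀ s ∈ Set.Icc (0 : ℝ) 1, X + s • W ∈ closure (omega 𝔞) := fun s hs =>
    (convex_omega 𝔞).closure.add_smul_sub_mem hX hY hs
  have hmem : ∀ r ∈ Set.Icc (0 : ℝ) 1, ∀ z : ℂ, z.re ∈ Set.Icc (0 : ℝ) 1 →
      (Q r z : GC ⧸ complexifiedSubgroup E E' ι K) ∈ closure (crown E' ι K 𝔞) := by
    intro r hr z hz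
    rw [hQ]
    refine orbitPoint_mem_closure_crown hι h𝔞 ?_ _
    exact (convex_omega 𝔞).closure.smul_mem_of_zero_mem (subset_closure (zero_mem_omega 𝔞))
      (hseg _ hz) hr
  have hmem' : ∀ r ∈ Set.Ico (0 : ℝ) 1, ∀ z : ℂ, z.re ∈ Set.Icc (0 : ℝ) 1 →
      (Q r z : GC ⧸ complexifiedSubgroup E E' ι K) ∈ crown E' ι K 𝔞 := by
    intro r hr z hz
    rw [hQ]
    exact orbitPoint_mem_crown (smul_mem_omega (hseg _ hz) hr.1 hr.2) _
  have hQc : Continuous (Function.uncurry Q) := by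
    have h1 : Continuous fun p : ℝ × ℂ =>
        complexExp E' ι ((p.1 • W : 𝔞) : GroupLieAlgebra 𝓘(ℝ, E) G) (Complex.I * p.2) := by
      simp only [Submodule.coe_smul, complexExp_smul hι]
      exact (mdifferentiable_complexExp _).continuous.comp (by fun_prop)
    have h2 : Continuous fun p : ℝ × ℂ =>
        expI E' ι ((p.1 • X : 𝔞) : GroupLieAlgebra 𝓘(ℝ, E) G) :=
      (continuous_expI_smul hι (X : GroupLieAlgebra 𝓘(ℝ, E) G)).comp continuous_fst
    exact (continuous_const.mul h1).mul h2
  have hQd : ∀ r, MDifferentiable 𝓘(ℂ, ℂ) 𝓘(ℂ, E') (Q r) := by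
    intro r
    have h1 : MDifferentiable 𝓘(ℂ, ℂ) 𝓘(ℂ, ℂ) (fun z : ℂ => Complex.I * z) :=
      (differentiable_id.const_mul Complex.I).mdifferentiable
    have h2 : MDifferentiable 𝓘(ℂ, E') 𝓘(ℂ, E') (fun x : GC => ι g * x *
        expI E' ι ((r • X : 𝔞) : GroupLieAlgebra 𝓘(ℝ, E) G)) :=
      ((contMDiff_mul_right (I := 𝓘(ℂ, E')) (n := ω)).comp
        (contMDiff_mul_left (I := 𝓘(ℂ, E')) (n := ω) (a := ι g))).mdifferentiable (by simp)
    exact h2.comp ((mdifferentiable_complexExp _).comp h1)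
  let F : ℝ → ℂ → ℂ := fun r z => f (Q r z : GC ⧸ complexifiedSubgroup E E' ι K)
  have key : ‖F 1 (t : ℂ)‖ ≤ C := by
    refine norm_le_on_strip_of_limit (F := F) (M := M) ?_ ?_ ?_ ?_ ?_ (by simpa using ht)
    · exact hf.1.comp (QuotientGroup.continuous_mk.comp hQc).continuousOn
        fun p hp => hmem p.1 hp.1 p.2 hp.2
    · intro r hr
      have h3 : MDifferentiableOn 𝓘(ℂ, ℂ) 𝓘(ℂ, ℂ) (F r) (Complex.re ⁻¹' Set.Ioo 0 1) :=
        hf.2.1.comp (hQd r).mdifferentiableOn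
          fun z hz => hmem' r hr z (Set.Ioo_subset_Icc_self hz)
      exact mdifferentiableOn_iff_differentiableOn.1 h3
    · exact fun z hz => hM _ (hmem 1 (by simp) z hz)
    · intro z hz
      have := hQ 1 z
      rw [hz, zero_smul, add_zero, one_smul, one_smul] at this
      change ‖f (Q 1 z : GC ⧸ complexifiedSubgroup E E' ι K)‖ ≤ C
      rw [this]
      exact hCX _
    · intro z hz
      have := hQ 1 z
      rw [hz, one_smul, one_smul, add_sub_cancel] at this
      change ‖f (Q 1 z : GC ⧸ complexifiedSubgroup E E' ι K)‖ ≤ C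
      rw [this]
      exact hCY _
  have e1 := hQ 1 t
  -- At the real point `t` the extra factor from `G` is `exp 0 = 1`, which leaves `g` itself.
  have e2 : ((-(t : ℂ).im) • ((((1 : ℝ) • W : 𝔞)) : GroupLieAlgebra 𝓘(ℝ, E) G)) =
      (0 : ℝ) • ((((1 : ℝ) • W : 𝔞)) : GroupLieAlgebra 𝓘(ℝ, E) G) := by simp
  have e3 := (isOneParameterSubgroup_lieExp_real
    ((((1 : ℝ) • W : 𝔞)) : GroupLieAlgebra 𝓘(ℝ, E) G)).map_zero
  rw [e2, e3, mul_one, one_smul, Complex.ofReal_re] at e1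
  rw [← e1]
  exact key

/-- The maximum principle for `𝒜(Ξ)`: a bound on the distinguished boundary is a bound on the
crown. -/
theorem norm_le_of_norm_le_on_distinguishedBoundary (hι : ContMDiff 𝓘(ℝ, E) 𝓘(ℝ, E') ∞ ι)
    {θ : GroupLieAlgebra 𝓘(ℝ, E) G →ₗ⁅ℝ⁆ GroupLieAlgebra 𝓘(ℝ, E) G} (hθ : IsCartanInvolution θ)
    (h𝔞 : IsAbelianSubspaceOfP θ 𝔞)
    {f : ComplexQuotient E E' ι K → ℂ} (hf : f ∈ crownAlgebra E' ι K 𝔞) {M C : ℝ}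
    (hM : ∀ z ∈ closure (crown E' ι K 𝔞), ‖f z‖ ≤ M)
    (hC : ∀ z ∈ distinguishedBoundary E' ι K 𝔞, ‖f z‖ ≤ C) :
    ∀ z ∈ crown E' ι K 𝔞, ‖f z‖ ≤ C := by
  have : FiniteDimensional ℝ (GroupLieAlgebra 𝓘(ℝ, E) G) := inferInstanceAs (FiniteDimensional ℝ E)
  have : T2Space (GroupLieAlgebra 𝓘(ℝ, E) G) := inferInstanceAs (T2Space E)
  have : LocallyConvexSpace ℝ (GroupLieAlgebra 𝓘(ℝ, E) G) :=
    inferInstanceAs (LocallyConvexSpace ℝ E)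
  let D : Set 𝔞 := {X | X ∈ closure (omega 𝔞) ∧ ∀ g, ‖f (orbitPoint E' ι K g X)‖ ≤ C}
  have hconv : Convex ℝ D := by
    rintro X ⟨hX, hCX⟩ Y ⟨hY, hCY⟩ a b ha hb hab
    refine ⟨(convex_omega 𝔞).closure hX hY ha hb hab, fun g => ?_⟩
    have e : a • X + b • Y = X + b • (Y - X) := by
      rw [eq_sub_of_add_eq hab]
      module
    rw [e]
    exact norm_le_on_segment hι h𝔞.2 hf hM hX hY hCX hCY ⟨hb, by linarith⟩ g
  have hclosed : IsClosed D := by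
    -- For each fixed `g` the condition is closed, by continuity of `f` along `X ↦ g exp(iX) K_ℂ` on
    -- the closure of `Ω`.
    have : D = ⋂ g : G, closure (omega 𝔞) ∩
        (fun X => f (orbitPoint E' ι K g X)) ⁻¹' Metric.closedBall 0 C := by
      ext X
      simp [D, Set.mem_iInter, forall_and]
    rw [this]
    refine isClosed_iInter fun g => ContinuousOn.preimage_isClosed_of_isClosed ?_ isClosed_closure
      Metric.isClosed_closedBall
    exact hf.1.comp (continuous_orbitPoint hι h𝔞.2 g).continuousOn
      fun X hX => orbitPoint_mem_closure_crown hι h𝔞.2 hX g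
  have hD : extremeOmega 𝔞 ⊆ D := fun X hX => ⟨hX.1, fun g => hC _ ⟨g, X, hX, rfl⟩⟩
  rintro z ⟨g, X, hX, rfl⟩
  exact (omega_subset_of_extremeOmega_subset hθ h𝔞 hconv hclosed hD (subset_closure hX)).2 g

end CrownDomain
end Crown
end

/-! ### The main theorem. -/

theorem theorem2p3
    {E : Type*} [NormedAddCommGroup E] [NormedSpace ℝ E] [FiniteDimensional ℝ E] [CompleteSpace E]
    {G : Type u} [TopologicalSpace G] [T2Space G] [ChartedSpace E G] [Group G]
    [LieGroup 𝓘(ℝ, E) ∞ G]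
    [LieAlgebra.IsSemisimple ℝ (GroupLieAlgebra 𝓘(ℝ, E) G)]
    {E' : Type*} [NormedAddCommGroup E'] [NormedSpace ℂ E'] [FiniteDimensional ℂ E']
    {GC : Type u} [TopologicalSpace GC] [T2Space GC] [ChartedSpace E' GC] [Group GC]
    [LieGroup 𝓘(ℂ, E') ω GC]
    (ι : G →* GC) (hι : Crown.IsUniversalComplexification E E' ι)
    (hι_inj : Function.Injective ι)
    (K : Subgroup G) (hK : Maximal (fun L : Subgroup G => IsCompact (L : Set G)) K)
    (θ : GroupLieAlgebra 𝓘(ℝ, E) G →ₗ⁅ℝ⁆ GroupLieAlgebra 𝓘(ℝ, E) G)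
    (hθ : Crown.IsCartanInvolution θ)
    (hKθ : Crown.lieAlgebraOf E K = {X | θ X = X})
    (𝔞 : Submodule ℝ (GroupLieAlgebra 𝓘(ℝ, E) G))
    (h𝔞 : Maximal (Crown.IsAbelianSubspaceOfP θ) 𝔞)
    (f : Crown.ComplexQuotient E E' ι K → ℂ)
    (hf : f ∈ Crown.crownAlgebra E' ι K 𝔞) :
    (Crown.distinguishedBoundary E' ι K 𝔞).Nonempty ∧
    Crown.distinguishedBoundary E' ι K 𝔞 ⊆ closure (Crown.crown E' ι K 𝔞) ∧
    BddAbove ((fun z => ‖f z‖) '' Crown.distinguishedBoundary E' ι K 𝔞) ∧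
    sSup ((fun z => ‖f z‖) '' Crown.crown E' ι K 𝔞) =
      sSup ((fun z => ‖f z‖) '' Crown.distinguishedBoundary E' ι K 𝔞) := by
  have : CompleteSpace E' := FiniteDimensional.complete ℂ E'
  have : FiniteDimensional ℝ (GroupLieAlgebra 𝓘(ℝ, E) G) := inferInstanceAs (FiniteDimensional ℝ E)
  have : T2Space (GroupLieAlgebra 𝓘(ℝ, E) G) := inferInstanceAs (T2Space E)
  have : LocallyConvexSpace ℝ (GroupLieAlgebra 𝓘(ℝ, E) G) :=
    inferInstanceAs (LocallyConvexSpace ℝ E)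
  have hbdd := hf.2.2
  -- Continuity carries the supremum bound to the closure. It yields boundedness on the
  -- distinguished boundary and one inequality, and it is the a priori bound that Phragmén–Lindelöf
  -- needs for the other.
  have hM : ∀ z ∈ closure (Crown.crown E' ι K 𝔞),
      ‖f z‖ ≤ sSup ((fun z => ‖f z‖) '' Crown.crown E' ι K 𝔞) := fun z hz =>
    le_on_closure (fun z hz => le_csSup hbdd (Set.mem_image_of_mem _ hz)) hf.1.norm
      continuousOn_const hz
  have hsub : Crown.distinguishedBoundary E' ι K 𝔞 ⊆ closure (Crown.crown E' ι K 𝔞) := by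
    rintro z ⟨g, X, hX, rfl⟩
    exact Crown.orbitPoint_mem_closure_crown hι.smooth h𝔞.prop.2 hX.1 g
  have hne : (Crown.distinguishedBoundary E' ι K 𝔞).Nonempty := by
    obtain ⟨X, hX⟩ := Crown.extremeOmega_nonempty hθ h𝔞.prop
    exact ⟨Crown.orbitPoint E' ι K 1 X, 1, X, hX, rfl⟩
  have hbdd' : BddAbove ((fun z => ‖f z‖) '' Crown.distinguishedBoundary E' ι K 𝔞) :=
    ⟨_, Set.forall_mem_image.2 fun z hz => hM z (hsub hz)⟩
  refine ⟨hne, hsub, hbdd', le_antisymm ?_ ?_⟩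
  · refine csSup_le (Set.Nonempty.image _
      ⟨_, Crown.orbitPoint_mem_crown (Crown.zero_mem_omega 𝔞) 1⟩) (Set.forall_mem_image.2 ?_)
    exact Crown.norm_le_of_norm_le_on_distinguishedBoundary hι.smooth hθ h𝔞.prop hf hM
      fun z hz => le_csSup hbdd' (Set.mem_image_of_mem _ hz)
  · exact csSup_le (hne.image _) (Set.forall_mem_image.2 fun z hz => hM z (hsub hz))
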